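/- For a Tychonoff (completely regular Hausdorff) space $X$ and a real locally convex space $E$, let $C_p(X,E)$ be the vector space of all continuous functions $X\to E$ with the topology of pointwise convergence, that is, the topology inherited from the product $E^X$, and put $C_p(X)=C_p(X,\mathbb{R})$. Let $(c_0)_p=\{x\in\mathbb{R}^{\mathbb{N}}: x(n)\to 0\}$ with the pointwise topology inherited from $\mathbb{R}^{\mathbb{N}}$. A barrel in $E$ is a closed, convex, balanced and absorbing subset, and a set $B\subseteq E$ is barrel-bounded if it is absorbed by every barrel in $E$. Let $E'$ be the topological dual of $E$, let $\sigma(E',E)$ be the weak* topology, and let $\beta^*(E',E)$ be the topology on $E'$ of uniform convergence on the barrel-bounded subsets of $E$. The space $E$ has the Josefson–Nissenzweig property (JNP) if the identity map $(E',\sigma(E',E))\to(E',\beta^*(E',E))$ is not sequentially continuous. A locally convex space $E$ contains a complemented copy of a locally convex space $F$ if there are closed linear subspaces $E_1,E_2$ of $E$ such that $E=E_1\oplus E_2$ algebraically, $E_1$ is linearly homeomorphic to $F$, and the projection of $E$ onto $E_1$ along $E_2$ is continuous. **Theorem.** Let $X$ and $Y$ be infinite Tychonoff spaces. Then the following conditions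 are equivalent: 1. $C_p(X,C_p(Y))$ has the JNP; 2. $C_p(X,C_p(Y))$ contains a complemented copy of $(c_0)_p$; 3. $C_p(X,C_p(Y))$ admits a continuous linear surjection onto $(c_0)_p$; 4. $C_p(X)$ contains a complemented copy of $(c_0)_p$ or $C_p(Y)$ contains a complemented copy of $(c_0)_p$; 5. $C_p(X)$ admits a continuous linear surjection onto $(c_0)_p$ or $C_p(Y)$ admits a continuous linear surjection onto $(c_0)_p$; 6. $C_p(X)$ has the JNP or $C_p(Y)$ has the JNP. -/

import Mathlib

open Filter Topology

/-- `C_p(X, E)`: the continuous functions `X → E`, as a linear subspace of the product `X → E`.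
Being a subspace of a product, it carries the topology of pointwise convergence. -/
abbrev Cp (X E : Type*) [TopologicalSpace X] [AddCommGroup E] [Module ℝ E] [TopologicalSpace E]
    [IsTopologicalAddGroup E] [ContinuousSMul ℝ E] :=
  ↥(continuousSubmodule X ℝ E)

/-- The linear subspace of `ℝ^ℕ` formed by the sequences that converge to `0`. -/
def nullSequences : Submodule ℝ (ℕ → ℝ) where
  carrier := {x | Tendsto x atTop (𝓝 0)}
  add_mem' := by
    intro x y hx hy
    have h := Tendsto.add (f := x) (g := y) hx hy
    rw [add_zero] at h
    exact h
  zero_mem' := tendsto_const_nhds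
  smul_mem' := by
    intro c x hx
    have h := Tendsto.const_smul (f := x) hx c
    rw [smul_zero] at h
    exact h

/-- `(c_0)_p`: the null sequences with the pointwise topology inherited from `ℝ^ℕ`. -/
abbrev C0p := ↥nullSequences

section LocallyConvex

variable (E F : Type*) [AddCommGroup E] [Module ℝ E] [TopologicalSpace E]
  [AddCommGroup F] [Module ℝ F] [TopologicalSpace F]

/-- `E` contains a complemented copy of `F`: it is the direct sum of closed linear subspaces
`E₁` and `E₂`, where `E₁` is linearly homeomorphic to `F` and the projection of `E` onto `E₁`
along `E₂` is continuous. -/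
def ContainsComplementedCopy : Prop :=
  ∃ E₁ E₂ : Submodule ℝ E, IsClosed (E₁ : Set E) ∧ IsClosed (E₂ : Set E) ∧
    Nonempty (E₁ ≃L[ℝ] F) ∧
    ∃ h : IsCompl E₁ E₂, Continuous (E₁.projectionOnto E₂ h)

/-- `E` admits a continuous linear surjection onto `F`. -/
def MapsLinearlyOnto : Prop :=
  ∃ T : E →L[ℝ] F, Function.Surjective T

variable {E}

/-- A barrel: a closed, convex, balanced and absorbing set. -/
structure IsBarrel (T : Set E) : Prop where
  isClosed : IsClosed T
  convex : Convex ℝ T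
  balanced : Balanced ℝ T
  absorbent : Absorbent ℝ T

/-- A set is barrel-bounded if every barrel absorbs it. -/
def IsBarrelBounded (B : Set E) : Prop :=
  ∀ T : Set E, IsBarrel T → Absorbs ℝ T B

variable (E)

/-- The dual `E'` with the topology `β*(E', E)` of uniform convergence on the barrel-bounded
subsets of `E`. -/
abbrev BetaStarDual :=
  UniformConvergenceCLM (RingHom.id ℝ) (E := E) ℝ {B : Set E | IsBarrelBounded B}

/-- The identity map of `E'` from `σ(E', E)` (the weak* topology) to `β*(E', E)`. -/
noncomputable def weakStarToBetaStar (φ : WeakDual ℝ E) : BetaStarDual E :=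
  UniformConvergenceCLM.ofFun (RingHom.id ℝ) ℝ {B : Set E | IsBarrelBounded B}
    (WeakDual.toStrongDual φ)

/-- The Josefson-Nissenzweig property: the identity map `(E', σ(E', E)) → (E', β*(E', E))` is not
sequentially continuous. -/
def HasJNP : Prop :=
  ¬ SeqContinuous (weakStarToBetaStar E)

end LocallyConvex

/-! A continuous map from X to C_p(Y) is the same thing as a separately continuous function on X ×
Y. Hence C_p(X, C_p(Y)) is C_p(Z), where Z is X × Y with the coarsest topology making these
functions continuous (`cpCpEquiv`). The dual of C_p(X) consists of the finitely supported measures,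
and the conditions are compared through `HasJN`: some sequence of such measures tends to 0 at every
continuous function but not in variation.

The JNP of C_p(X) amounts to `HasJN`. The unit ball of bounded functions is barrel-bounded, because
the Banach space of bounded continuous functions is barrelled; so `HasJN` gives the JNP. Conversely,
every continuous function is bounded on the union of the supports of a null sequence. A null
sequence whose variations t tend to 0 therefore stays null after division by √t, so it converges
uniformly on barrel-bounded sets. The same square root shows that the coordinates of a continuous
linear surjection onto (c_0)_p do not tend to 0 in variation.

For Z, boundedness on the supports is very restrictive: the supports lie in finitely many vertical
and horizontal lines (`exists_finset_cover_of_bounded`). Weighted projections of these lines to the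
factors carry `HasJN` from Z to X or Y (`HasJN.of_sepProd`).

Finally, `HasJN` on a Tychonoff space yields a complemented (c_0)_p. The measures are modified until
they live, up to a small triangular error, on disjoint open sets. Functions peaking there span the
copy, and solving the triangular system gives biorthogonal functionals that define the projection
(`HasJN.containsComplementedCopy`). Since C_p(X) and C_p(Y) are themselves complemented in C_p(X,
C_p(Y)), the copy passes to the latter. -/

section FiniteMeasures

/-! ### Variation of finitely supported signed measures -/

variable {X : Type*}

/-- The value of the finitely supported signed measure `μ` at the function `f`. -/
noncomputable def pairing (f : X → ℝ) : (X →₀ ℝ) →ₗ[ℝ] ℝ := Finsupp.linearCombination ℝ f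

/-- The variation of the finitely supported signed measure `μ` on the set `A`. -/
noncomputable def mass (μ : X →₀ ℝ) (A : Set X) : ℝ :=
  ∑ x ∈ μ.support, A.indicator (fun x => |μ x|) x

/-- The total variation of a finitely supported signed measure. -/
noncomputable def tv (μ : X →₀ ℝ) : ℝ := mass μ Set.univ

theorem pairing_eq_sum {μ : X →₀ ℝ} {s : Finset X} (hs : μ.support ⊆ s) (f : X → ℝ) :
    pairing f μ = ∑ x ∈ s, μ x * f x := by
  rw [pairing, Finsupp.linearCombination_apply, Finsupp.sum_of_support_subset _ hs] <;> simp

theorem mass_eq_sum {μ : X →₀ ℝ} {s : Finset X} (hs : μ.support ⊆ s) (A : Set X) :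
    mass μ A = ∑ x ∈ s, A.indicator (fun x => |μ x|) x := by
  refine Finset.sum_subset hs fun x _ hx => ?_
  rw [Finsupp.notMem_support_iff] at hx
  by_cases h : x ∈ A <;> simp [h, hx]

theorem tv_eq_sum {μ : X →₀ ℝ} {s : Finset X} (hs : μ.support ⊆ s) : tv μ = ∑ x ∈ s, |μ x| := by
  rw [tv, mass_eq_sum hs]; simp

theorem mass_nonneg (μ : X →₀ ℝ) (A : Set X) : 0 ≤ mass μ A :=
  Finset.sum_nonneg fun x _ => Set.indicator_nonneg (fun _ _ => abs_nonneg _) x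

theorem tv_nonneg (μ : X →₀ ℝ) : 0 ≤ tv μ := mass_nonneg μ _

theorem mass_mono (μ : X →₀ ℝ) {A B : Set X} (h : A ⊆ B) : mass μ A ≤ mass μ B :=
  Finset.sum_le_sum fun x _ => Set.indicator_le_indicator_of_subset h (fun _ => abs_nonneg _) x

theorem mass_le_tv (μ : X →₀ ℝ) (A : Set X) : mass μ A ≤ tv μ := mass_mono μ (Set.subset_univ A)

theorem mass_union_le (μ : X →₀ ℝ) (A B : Set X) : mass μ (A ∪ B) ≤ mass μ A + mass μ B := by
  rw [mass, mass, mass, ← Finset.sum_add_distrib]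
  refine Finset.sum_le_sum fun x _ => ?_
  have := abs_nonneg (μ x)
  by_cases hA : x ∈ A <;> by_cases hB : x ∈ B <;> simp [hA, hB]

theorem mass_empty (μ : X →₀ ℝ) : mass μ ∅ = 0 := by simp [mass]

theorem mass_biUnion_le {ι : Type*} (μ : X →₀ ℝ) (s : Finset ι) (A : ι → Set X) :
    mass μ (⋃ i ∈ s, A i) ≤ ∑ i ∈ s, mass μ (A i) := by
  classical
  induction s using Finset.induction_on with
  | empty => simp [mass_empty]
  | insert i s hi ih =>
    rw [Finset.set_biUnion_insert, Finset.sum_insert hi]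
    exact (mass_union_le _ _ _).trans (by gcongr)

theorem sum_mass_le_tv {ι : Type*} (μ : X →₀ ℝ) (s : Finset ι) (A : ι → Set X)
    (h : (s : Set ι).PairwiseDisjoint A) : ∑ i ∈ s, mass μ (A i) ≤ tv μ := by
  classical
  rw [tv_eq_sum subset_rfl]
  simp only [mass]
  rw [Finset.sum_comm]
  refine Finset.sum_le_sum fun x _ => ?_
  by_cases hx : ∃ i ∈ s, x ∈ A i
  · obtain ⟨i, hi, hxi⟩ := hx
    rw [Finset.sum_eq_single_of_mem i hi]
    · simp [hxi]
    · intro j hj hji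
      exact Set.indicator_of_notMem
        (fun hxj => Set.disjoint_left.1 (h (Finset.mem_coe.2 hj) (Finset.mem_coe.2 hi) hji) hxj hxi) _
  · push Not at hx
    rw [Finset.sum_eq_zero fun i hi => Set.indicator_of_notMem (hx i hi) _]
    exact abs_nonneg _

theorem mass_singleton (μ : X →₀ ℝ) (x : X) : mass μ {x} = |μ x| := by
  classical
  rw [mass_eq_sum (s := insert x μ.support) (Finset.subset_insert _ _),
    Finset.sum_eq_single_of_mem x (Finset.mem_insert_self _ _)]
  · simp
  · intro y _ hy
    simp [hy]

theorem abs_apply_le_tv (μ : X →₀ ℝ) (x : X) : |μ x| ≤ tv μ :=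
  mass_singleton μ x ▸ mass_le_tv μ _

theorem mass_coe_finset (μ : X →₀ ℝ) (s : Finset X) : mass μ s = ∑ x ∈ s, |μ x| := by
  classical
  rw [mass_eq_sum (s := s ∪ μ.support) Finset.subset_union_right]
  simp only [Set.indicator_apply, Finset.mem_coe]
  rw [Finset.sum_ite_mem, Finset.inter_eq_right.2 Finset.subset_union_left]

theorem tv_smul (c : ℝ) (μ : X →₀ ℝ) : tv (c • μ) = |c| * tv μ := by
  rw [tv_eq_sum (Finsupp.support_smul (b := c) (g := μ)), tv_eq_sum subset_rfl, Finset.mul_sum]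
  simp [abs_mul]

theorem tv_sub_le (μ ν : X →₀ ℝ) : tv (μ - ν) ≤ tv μ + tv ν := by
  classical
  rw [tv_eq_sum (s := μ.support ∪ ν.support) Finsupp.support_sub,
    tv_eq_sum (μ := μ) (s := μ.support ∪ ν.support) Finset.subset_union_left,
    tv_eq_sum (μ := ν) (s := μ.support ∪ ν.support) Finset.subset_union_right,
    ← Finset.sum_add_distrib]
  exact Finset.sum_le_sum fun x _ => abs_sub _ _

theorem tv_eq_zero {μ : X →₀ ℝ} (h : tv μ = 0) : μ = 0 := by
  ext x
  have := abs_apply_le_tv μ x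
  simpa using abs_nonpos_iff.1 (h ▸ this)

/-- A function that vanishes off `A` is integrated with the variation on `A`. -/
theorem abs_pairing_le_mass {μ : X →₀ ℝ} {f : X → ℝ} {C : ℝ} {A : Set X}
    (hC : ∀ x ∈ μ.support, |f x| ≤ C) (hA : ∀ x ∈ μ.support, x ∉ A → f x = 0) :
    |pairing f μ| ≤ C * mass μ A := by
  rw [pairing_eq_sum subset_rfl, mass, Finset.mul_sum]
  refine (Finset.abs_sum_le_sum_abs _ _).trans (Finset.sum_le_sum fun x hx => ?_)
  by_cases h : x ∈ A
  · rw [Set.indicator_of_mem h, abs_mul, mul_comm]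
    exact mul_le_mul_of_nonneg_right (hC x hx) (abs_nonneg _)
  · simp [h, hA x hx h]

theorem abs_pairing_le_tv {μ : X →₀ ℝ} {f : X → ℝ} {C : ℝ} (hC : ∀ x ∈ μ.support, |f x| ≤ C) :
    |pairing f μ| ≤ C * tv μ :=
  abs_pairing_le_mass hC (fun _ _ h => absurd (Set.mem_univ _) h)

end FiniteMeasures

/-! ### Triangular systems -/

section ForwardSubstitution

/-- A lower triangular system with unit diagonal is solvable. -/
theorem exists_forward_substitution {M : Type*} [AddCommGroup M] [Module ℝ M]
    (a : ℕ → ℕ → ℝ) (d : ℕ → M) :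
    ∃ c : ℕ → M, ∀ j, c j = d j - ∑ k ∈ Finset.range j, a j k • c k := by
  have key : ∀ n, ∃ c : ℕ → M, ∀ j < n, c j = d j - ∑ k ∈ Finset.range j, a j k • c k := by
    intro n
    induction n with
    | zero => exact ⟨0, fun j hj => absurd hj (Nat.not_lt_zero j)⟩
    | succ n ih =>
      obtain ⟨c, hc⟩ := ih
      refine ⟨Function.update c n (d n - ∑ k ∈ Finset.range n, a n k • c k), fun j hj => ?_⟩
      have hs : ∀ i ≤ n, ∑ k ∈ Finset.range i, a i k •
          (Function.update c n (d n - ∑ k ∈ Finset.range n, a n k • c k)) k =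
          ∑ k ∈ Finset.range i, a i k • c k := by
        intro i hi
        refine Finset.sum_congr rfl fun k hk => ?_
        rw [Function.update_of_ne (by have := Finset.mem_range.1 hk; omega)]
      rcases (Nat.lt_succ_iff.1 hj).eq_or_lt with rfl | h
      · rw [hs j le_rfl, Function.update_self]
      · rw [hs j h.le, Function.update_of_ne h.ne, hc j h]
  choose c hc using key
  -- Finite solutions of different lengths agree where both are defined, so their diagonal solves
  -- the whole system.
  have huniq : ∀ j n m, j < n → j < m → c n j = c m j := by
    intro j
    induction j using Nat.strong_induction_on with
    | _ j ih =>
      intro n m hn hm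
      rw [hc n j hn, hc m j hm]
      congr 1
      refine Finset.sum_congr rfl fun k hk => ?_
      have hk := Finset.mem_range.1 hk
      rw [ih k hk n m (hk.trans hn) (hk.trans hm)]
  refine ⟨fun j => c (j + 1) j, fun j => ?_⟩
  simp only
  rw [hc (j + 1) j (Nat.lt_succ_self j)]
  congr 1
  refine Finset.sum_congr rfl fun k hk => ?_
  have hk := Finset.mem_range.1 hk
  rw [huniq k (j + 1) (k + 1) (by omega) (by omega)]

end ForwardSubstitution

/-! ### Interpolation, and functional boundedness of the supports of null sequences -/

section Interpolation

variable {X : Type*} [TopologicalSpace X]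

variable (X) in
/-- The continuous real functions separate the points of `X`. -/
def FunctionallyHausdorff : Prop :=
  ∀ x y : X, x ≠ y → ∃ f : X → ℝ, Continuous f ∧ f x ≠ f y

theorem FunctionallyHausdorff.exists_one_zero (hX : FunctionallyHausdorff X) {x : X} {F : Finset X}
    (hx : x ∉ F) : ∃ f : X → ℝ, Continuous f ∧ f x = 1 ∧ ∀ y ∈ F, f y = 0 := by
  classical
  induction F using Finset.induction_on with
  | empty => exact ⟨fun _ => 1, continuous_const, rfl, by simp⟩
  | insert y F hy ih =>
    rw [Finset.mem_insert, not_or] at hx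
    obtain ⟨f, hf, hfx, hfF⟩ := ih hx.2
    obtain ⟨g, hg, hgxy⟩ := hX x y hx.1
    have h0 : g x - g y ≠ 0 := sub_ne_zero.2 hgxy
    refine ⟨fun z => f z * ((g z - g y) / (g x - g y)),
      hf.mul ((hg.sub continuous_const).div_const _), by simp [hfx, h0], fun z hz => ?_⟩
    rcases Finset.mem_insert.1 hz with rfl | hz
    · simp
    · simp [hfF z hz]

theorem FunctionallyHausdorff.exists_interpolation (hX : FunctionallyHausdorff X) (F : Finset X)
    {g : X → ℝ} (hg : ∀ x ∈ F, |g x| ≤ 1) :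
    ∃ f : X → ℝ, Continuous f ∧ (∀ x, |f x| ≤ 1) ∧ ∀ x ∈ F, f x = g x := by
  classical
  have h : ∃ f : X → ℝ, Continuous f ∧ ∀ x ∈ F, f x = g x := by
    choose f hf hf1 hf0 using fun x => hX.exists_one_zero (Finset.notMem_erase x F)
    refine ⟨fun z => ∑ x ∈ F, g x * f x z,
      continuous_finsetSum _ fun x _ => continuous_const.mul (hf x), fun z hz => ?_⟩
    simp only
    rw [Finset.sum_eq_single_of_mem z hz, hf1, mul_one]
    intro x _ hxz
    rw [hf0 x z (Finset.mem_erase.2 ⟨hxz.symm, hz⟩), mul_zero]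
  obtain ⟨f, hf, hfg⟩ := h
  refine ⟨fun x => max (-1) (min (f x) 1), continuous_const.max (hf.min continuous_const),
    fun x => abs_le.2 ⟨le_max_left _ _, max_le (by norm_num) (min_le_right _ _)⟩, fun x hx => ?_⟩
  have := abs_le.1 (hg x hx)
  rw [← hfg x hx] at this ⊢
  simp only
  rw [min_eq_left this.2, max_eq_right this.1]

theorem FunctionallyHausdorff.exists_norming (hX : FunctionallyHausdorff X) (μ : X →₀ ℝ) :
    ∃ f : X → ℝ, Continuous f ∧ (∀ x, |f x| ≤ 1) ∧ pairing f μ = tv μ := by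
  obtain ⟨f, hf, hf1, hfs⟩ := hX.exists_interpolation μ.support
    (g := fun x => SignType.sign (μ x)) (fun x _ => by
      rcases lt_trichotomy (μ x) 0 with h | h | h <;> simp [h])
  refine ⟨f, hf, hf1, ?_⟩
  rw [pairing_eq_sum subset_rfl, tv_eq_sum subset_rfl]
  refine Finset.sum_congr rfl fun x hx => ?_
  rw [hfs x hx, mul_comm, sign_mul_self]

/-- The supports of a pointwise bounded sequence of finitely supported measures lie in a
functionally bounded set. -/
theorem FunctionallyHausdorff.exists_bound_on_supports (hX : FunctionallyHausdorff X)
    {μ : ℕ → X →₀ ℝ}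
    (hμ : ∀ f : X → ℝ, Continuous f → ∃ C, ∀ n, |pairing f (μ n)| ≤ C) {g : X → ℝ}
    (hg : Continuous g) : ∃ C, ∀ n, ∀ x ∈ (μ n).support, |g x| ≤ C := by
  classical
  by_contra! hunb
  -- If g is unbounded on the supports, measures can be picked so that each has a support point
  -- where |g| exceeds by 2 its values on all earlier supports.
  obtain ⟨p, hp, hr⟩ := exists_seq_of_forall_finset_exists
    (fun p : ℕ × X => p.2 ∈ (μ p.1).support)
    (fun p q => ∀ z ∈ (μ p.1).support, |g z| + 2 < |g q.2|) (by
      intro s _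
      obtain ⟨n, x, hx, h⟩ := hunb (∑ p ∈ s, ∑ z ∈ (μ p.1).support, (|g z| + 2))
      refine ⟨(n, x), hx, fun q hq z hz => lt_of_le_of_lt ?_ h⟩
      calc |g z| + 2 ≤ ∑ z ∈ (μ q.1).support, (|g z| + 2) :=
            Finset.single_le_sum (f := fun z => |g z| + 2) (fun _ _ => by positivity) hz
        _ ≤ _ := Finset.single_le_sum
            (f := fun p : ℕ × X => ∑ z ∈ (μ p.1).support, (|g z| + 2))
            (fun _ _ => Finset.sum_nonneg fun _ _ => by positivity) hq)
  set ν : ℕ → X →₀ ℝ := fun k => μ (p k).1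
  set x : ℕ → X := fun k => (p k).2
  have hx : ∀ k, x k ∈ (ν k).support := hp
  have hgap : ∀ j k, j < k → ∀ z ∈ (ν j).support, |g z| + 2 < |g (x k)| := hr
  choose h hh h1 h0 using fun k => hX.exists_one_zero (Finset.notMem_erase (x k) (ν k).support)
  -- The factor `h k` isolates `x k` within the support of `ν k`. The tent in |g| confines `b k` to
  -- values of |g| within 1 of |g (x k)|, so `b k` vanishes on earlier supports and the family is
  -- locally finite.
  let b : ℕ → X → ℝ := fun k z => h k z * max 0 (1 - |(|g z| - |g (x k)|)|)
  have hb : ∀ k, Continuous (b k) := fun k =>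
    (hh k).mul (continuous_const.max (continuous_const.sub (hg.abs.sub continuous_const).abs))
  have hbne : ∀ k z, b k z ≠ 0 → |(|g z| - |g (x k)|)| < 1 := by
    intro k z hz
    by_contra! hge
    exact hz (by simp only [b]; rw [max_eq_left (by linarith), mul_zero])
  have hbdiag : ∀ k, pairing (b k) (ν k) = ν k (x k) := by
    intro k
    rw [pairing_eq_sum subset_rfl, Finset.sum_eq_single_of_mem _ (hx k)]
    · simp [b, h1]
    · intro z hz hzx
      simp [b, h0 k z (Finset.mem_erase.2 ⟨hzx, hz⟩)]
  have hbabove : ∀ j k, j < k → ∀ z ∈ (ν j).support, b k z = 0 := by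
    intro j k hjk z hz
    by_contra hne
    have h1 := (abs_lt.1 (hbne k z hne)).1
    have h2 := hgap j k hjk z hz
    linarith
  have hgrow : ∀ k : ℕ, (k : ℝ) ≤ |g (x k)| := by
    intro k
    induction k with
    | zero => simp
    | succ k ih =>
      have := hgap k (k + 1) (Nat.lt_succ_self k) _ (hx k)
      push_cast
      linarith
  have hlf : LocallyFinite fun k => Function.support (b k) := by
    intro z
    refine ⟨{y | |g y| < |g z| + 1}, (isOpen_lt hg.abs continuous_const).mem_nhds (by simp), ?_⟩
    obtain ⟨N, hN⟩ := exists_nat_gt (|g z| + 2)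
    refine (Set.finite_lt_nat N).subset ?_
    rintro k ⟨y, hyk, hyz⟩
    have h1 := (abs_lt.1 (hbne k y hyk)).1
    have h2 : |g y| < |g z| + 1 := hyz
    have h3 := hgrow k
    exact_mod_cast (by linarith : (k : ℝ) < N)
  have hne : ∀ k, ν k (x k) ≠ 0 := fun k => Finsupp.mem_support_iff.1 (hx k)
  -- The matrix of pairings is triangular with nonzero diagonal `ν j (x j)`. The coefficients are
  -- chosen so that Σ c_k b_k has integral j against `ν j`, which is unbounded in j.
  obtain ⟨c, hc⟩ := exists_forward_substitution (M := ℝ)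
    (fun j k => pairing (b k) (ν j) / ν j (x j)) (fun j => (j : ℝ) / ν j (x j))
  let f : X → ℝ := fun z => ∑ᶠ k, c k * b k z
  have hf : Continuous f := continuous_finsum (fun k => continuous_const.mul (hb k))
    (hlf.subset fun k => by
      intro z hz
      simp only [Function.mem_support] at hz ⊢
      exact right_ne_zero_of_mul hz)
  have hval : ∀ j, pairing f (ν j) = j := by
    intro j
    have hsum : ∀ z ∈ (ν j).support, f z = ∑ k ∈ Finset.range (j + 1), c k * b k z := by
      intro z hz
      refine finsum_eq_sum_of_support_subset _ fun k hk => ?_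
      by_contra hkj
      simp only [Finset.coe_range, Set.mem_Iio, not_lt] at hkj
      exact hk (by simp only; rw [hbabove j k (by omega) z hz, mul_zero])
    have : pairing f (ν j) = ∑ k ∈ Finset.range (j + 1), c k * pairing (b k) (ν j) := by
      rw [pairing_eq_sum subset_rfl, Finset.sum_congr rfl fun z hz => by rw [hsum z hz]]
      simp only [pairing_eq_sum (μ := ν j) subset_rfl, Finset.mul_sum]
      rw [Finset.sum_comm]
      exact Finset.sum_congr rfl fun _ _ => Finset.sum_congr rfl fun _ _ => by ring
    rw [this, Finset.sum_range_succ, hbdiag, hc j]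
    simp only [smul_eq_mul]
    rw [sub_mul, div_mul_cancel₀ _ (hne j), Finset.sum_mul]
    have hk : ∀ k ∈ Finset.range j,
        pairing (b k) (ν j) / ν j (x j) * c k * ν j (x j) = c k * pairing (b k) (ν j) := by
      intro k _
      have := hne j
      field_simp
    rw [Finset.sum_congr rfl hk]
    ring
  obtain ⟨C, hC⟩ := hμ f hf
  obtain ⟨j, hj⟩ := exists_nat_gt C
  have := hC (p j).1
  rw [show pairing f (μ (p j).1) = j from hval j] at this
  linarith [le_abs_self (j : ℝ)]

/-- A sequence of finitely supported measures that converges to `0` at every continuous function. -/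
def IsNullSeq (μ : ℕ → X →₀ ℝ) : Prop :=
  ∀ f : X → ℝ, Continuous f → Tendsto (fun n => pairing f (μ n)) atTop (𝓝 0)

variable (X) in
/-- There is a null sequence of finitely supported measures that does not converge to `0` in the
variation norm. -/
def HasJN : Prop :=
  ∃ μ : ℕ → X →₀ ℝ, IsNullSeq μ ∧ ¬ Tendsto (fun n => tv (μ n)) atTop (𝓝 0)

theorem exists_abs_le_of_tendsto {u : ℕ → ℝ} {l : ℝ} (h : Tendsto u atTop (𝓝 l)) :
    ∃ C, ∀ n, |u n| ≤ C := by
  obtain ⟨C, hC⟩ := h.abs.bddAbove_range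
  exact ⟨C, fun n => hC ⟨n, rfl⟩⟩

theorem IsNullSeq.exists_bound_on_supports {μ : ℕ → X →₀ ℝ} (hμ : IsNullSeq μ)
    (hX : FunctionallyHausdorff X) {g : X → ℝ} (hg : Continuous g) :
    ∃ C, ∀ n, ∀ x ∈ (μ n).support, |g x| ≤ C :=
  hX.exists_bound_on_supports (fun f hf => exists_abs_le_of_tendsto (hμ f hf)) hg

theorem IsNullSeq.exists_abs_pairing_le {μ : ℕ → X →₀ ℝ} (hμ : IsNullSeq μ)
    (hX : FunctionallyHausdorff X) {g : X → ℝ} (hg : Continuous g) :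
    ∃ C, ∀ n, |pairing g (μ n)| ≤ C * tv (μ n) := by
  obtain ⟨C, hC⟩ := hμ.exists_bound_on_supports hX hg
  exact ⟨C, fun n => abs_pairing_le_tv (hC n)⟩

end Interpolation

/-! ### The dual of C_p(X) -/

section Dual

variable {X : Type*} [TopologicalSpace X]

/-- The continuous linear functional on `C_p(X)` given by a finitely supported measure. -/
noncomputable def measureCLM (μ : X →₀ ℝ) : Cp X ℝ →L[ℝ] ℝ :=
  ∑ x ∈ μ.support, μ x • (ContinuousLinearMap.proj x).comp (continuousSubmodule X ℝ ℝ).subtypeL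

@[simp]
theorem measureCLM_apply (μ : X →₀ ℝ) (f : Cp X ℝ) : measureCLM μ f = pairing f.1 μ := by
  rw [measureCLM, pairing_eq_sum subset_rfl]
  simp

/-- Every continuous linear functional on `C_p(X)` is a finitely supported measure. -/
theorem exists_eq_measureCLM (φ : Cp X ℝ →L[ℝ] ℝ) : ∃ μ : X →₀ ℝ, φ = measureCLM μ := by
  let e : X → Cp X ℝ →ₗ[ℝ] ℝ := fun x =>
    (LinearMap.proj x).comp (continuousSubmodule X ℝ ℝ).subtype
  have h : (φ : Cp X ℝ →ₗ[ℝ] ℝ) ∈ Submodule.span ℝ (Set.range e) := by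
    -- The functionals continuous for the topology induced by a family of functionals are its linear
    -- combinations; here the family is that of the evaluations.
    rw [LinearMap.mem_span_iff_continuous]
    have hφ : Continuous (φ : Cp X ℝ →ₗ[ℝ] ℝ) := φ.continuous
    convert hφ using 1
    rw [instTopologicalSpaceSubtype, Pi.topologicalSpace, induced_iInf]
    simp only [induced_compose]
    rfl
  obtain ⟨μ, hμ⟩ := (Finsupp.mem_span_range_iff_exists_finsupp).1 h
  refine ⟨μ, ContinuousLinearMap.ext fun f => ?_⟩
  rw [measureCLM_apply, pairing_eq_sum subset_rfl]
  have := congrArg (fun ψ : Cp X ℝ →ₗ[ℝ] ℝ => ψ f) hμ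
  simpa [Finsupp.sum, e] using this.symm

end Dual

/-! ### The JNP in terms of sequences of functionals -/

section JNP

variable {E F : Type*} [AddCommGroup E] [Module ℝ E] [TopologicalSpace E]
  [AddCommGroup F] [Module ℝ F] [TopologicalSpace F]

theorem tendsto_weakDual_iff {φ : ℕ → WeakDual ℝ E} {ψ : WeakDual ℝ E} :
    Tendsto φ atTop (𝓝 ψ) ↔ ∀ x, Tendsto (fun n => φ n x) atTop (𝓝 (ψ x)) :=
  WeakBilin.tendsto_iff_forall_eval_tendsto (topDualPairing ℝ E) ContinuousLinearMap.coe_injective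

theorem hasJNP_iff : HasJNP E ↔ ∃ φ : ℕ → E →L[ℝ] ℝ,
    (∀ x, Tendsto (fun n => φ n x) atTop (𝓝 0)) ∧
    ∃ B : Set E, IsBarrelBounded B ∧ ∃ ε > 0, ∃ᶠ n in atTop, ∃ b ∈ B, ε ≤ |φ n b| := by
  have key : ∀ (φ : ℕ → WeakDual ℝ E) (ψ : WeakDual ℝ E),
      Tendsto (weakStarToBetaStar E ∘ φ) atTop (𝓝 (weakStarToBetaStar E ψ)) ↔
      ∀ B : Set E, IsBarrelBounded B → ∀ ε > 0, ∀ᶠ n in atTop, ∀ b ∈ B, |ψ b - φ n b| < ε := by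
    intro φ ψ
    rw [UniformConvergenceCLM.tendsto_iff_tendstoUniformlyOn]
    simp only [Metric.tendstoUniformlyOn_iff, Real.dist_eq]
    rfl
  constructor
  · intro h
    simp only [HasJNP, SeqContinuous, not_forall] at h
    obtain ⟨φ, ψ, hφ, hn⟩ := h
    rw [key] at hn
    push Not at hn
    obtain ⟨B, hB, ε, hε, hf⟩ := hn
    refine ⟨fun n => WeakDual.toStrongDual (ψ - φ n), fun x => ?_, B, hB, ε, hε, hf⟩
    have := (tendsto_const_nhds (x := ψ x)).sub (tendsto_weakDual_iff.1 hφ x)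
    rwa [sub_self] at this
  · rintro ⟨φ, hφ, B, hB, ε, hε, hf⟩ h
    have h1 := h (x := fun n => StrongDual.toWeakDual (φ n)) (p := 0) (tendsto_weakDual_iff.2 hφ)
    rw [key] at h1
    obtain ⟨n, ⟨b, hb, hle⟩, hlt⟩ := (hf.and_eventually (h1 B hB ε hε)).exists
    have h2 : |(0 : ℝ) - φ n b| < ε := hlt b hb
    rw [zero_sub, abs_neg] at h2
    linarith

theorem IsBarrel.preimage {T : Set F} (hT : IsBarrel T) (e : E →L[ℝ] F) : IsBarrel (e ⁻¹' T) where
  isClosed := hT.isClosed.preimage e.continuous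
  convex := hT.convex.linear_preimage e.toLinearMap
  balanced := balanced_iff_smul_mem.2 fun a ha x hx => by
    simpa using hT.balanced.smul_mem ha hx
  absorbent := absorbent_iff_eventually_nhdsNE_zero.2 fun x => by
    simpa using absorbent_iff_eventually_nhdsNE_zero.1 hT.absorbent (e x)

theorem IsBarrelBounded.image {B : Set E} (hB : IsBarrelBounded B) (e : E ≃L[ℝ] F) :
    IsBarrelBounded (e '' B) := by
  intro T hT
  filter_upwards [hB _ (hT.preimage (e : E →L[ℝ] F))] with c hc
  rintro _ ⟨b, hb, rfl⟩
  obtain ⟨t, ht, rfl⟩ := hc hb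
  exact ⟨e t, ht, by simp⟩

theorem HasJNP.of_equiv (h : HasJNP E) (e : E ≃L[ℝ] F) : HasJNP F := by
  rw [hasJNP_iff] at h ⊢
  obtain ⟨φ, hφ, B, hB, ε, hε, hf⟩ := h
  refine ⟨fun n => (φ n).comp (e.symm : F →L[ℝ] E), fun x => hφ _, e '' B, hB.image e, ε, hε,
    hf.mono ?_⟩
  rintro n ⟨b, hb, hle⟩
  exact ⟨e b, ⟨b, hb, rfl⟩, by simpa using hle⟩

/-- A pointwise null sequence of functionals is uniformly bounded on barrel-bounded sets. -/
theorem IsBarrelBounded.exists_bound {B : Set E} (hB : IsBarrelBounded B) {φ : ℕ → E →L[ℝ] ℝ}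
    (hφ : ∀ x, Tendsto (fun n => φ n x) atTop (𝓝 0)) : ∃ C, ∀ n, ∀ b ∈ B, |φ n b| ≤ C := by
  -- The polar of the sequence is a barrel; it is absorbing because convergent scalar sequences are
  -- bounded.
  let T : Set E := {x | ∀ n, |φ n x| ≤ 1}
  have hT : IsBarrel T := by
    refine ⟨?_, ?_, ?_, ?_⟩
    · simp only [T, Set.ofPred_forall]
      exact isClosed_iInter fun n => isClosed_le (φ n).continuous.abs continuous_const
    · intro x hx y hy a b ha hb hab n
      calc |φ n (a • x + b • y)| = |a * φ n x + b * φ n y| := by simp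
        _ ≤ |a * φ n x| + |b * φ n y| := abs_add_le _ _
        _ = a * |φ n x| + b * |φ n y| := by rw [abs_mul, abs_mul, abs_of_nonneg ha, abs_of_nonneg hb]
        _ ≤ a * 1 + b * 1 := by gcongr <;> [exact hx n; exact hy n]
        _ = 1 := by linarith
    · rw [balanced_iff_smul_mem]
      intro a ha x hx n
      rw [map_smul, smul_eq_mul, abs_mul]
      exact mul_le_one₀ ha (abs_nonneg _) (hx n)
    · rw [absorbent_iff_eventually_nhdsNE_zero]
      intro x
      obtain ⟨C, hC⟩ := exists_abs_le_of_tendsto (hφ x)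
      have hC0 : 0 ≤ C := (abs_nonneg _).trans (hC 0)
      refine eventually_nhdsWithin_of_eventually_nhds ?_
      filter_upwards [Metric.ball_mem_nhds (0 : ℝ) (by positivity : 0 < (C + 1)⁻¹)] with c hc n
      rw [mem_ball_zero_iff, Real.norm_eq_abs] at hc
      rw [map_smul, smul_eq_mul, abs_mul]
      calc |c| * |φ n x| ≤ (C + 1)⁻¹ * (C + 1) := by
            gcongr
            exact (hC n).trans (by linarith)
        _ = 1 := inv_mul_cancel₀ (by positivity)
  obtain ⟨r, hr⟩ := (hB T hT).exists_pos
  obtain ⟨hr0, hr⟩ := hr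
  have := hr r (by simp [abs_of_pos hr0])
  refine ⟨r, fun n b hb => ?_⟩
  obtain ⟨t, ht, rfl⟩ := this hb
  simp only [map_smul, smul_eq_mul, abs_mul, abs_of_pos hr0]
  exact mul_le_of_le_one_right hr0.le (ht n)

theorem MapsLinearlyOnto.comp_left {G : Type*} [AddCommGroup G] [Module ℝ G] [TopologicalSpace G]
    (h : MapsLinearlyOnto F G) (T : E →L[ℝ] F) (hT : Function.Surjective T) :
    MapsLinearlyOnto E G := by
  obtain ⟨S, hS⟩ := h
  exact ⟨S.comp T, hS.comp hT⟩

end JNP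

/-! ### The JNP of C_p(X) in terms of measures -/

section UnitBall

open scoped BoundedContinuousFunction Pointwise

variable {X : Type*} [TopologicalSpace X]

/-- Banach spaces are barrelled. By Baire some multiple of T, hence T, has an interior point y; then
-y is interior by balance, and so is their midpoint 0. -/
theorem IsBarrel.mem_nhds_zero {E : Type*} [NormedAddCommGroup E] [NormedSpace ℝ E]
    [CompleteSpace E] {T : Set E} (hT : IsBarrel T) : T ∈ 𝓝 (0 : E) := by
  have hU : ⋃ n : ℕ, ((n : ℝ) + 1) • T = Set.univ := by
    refine Set.eq_univ_of_forall fun x => ?_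
    obtain ⟨r, hr0, hr⟩ := (hT.absorbent x).exists_pos
    obtain ⟨n, hn⟩ := exists_nat_gt r
    refine Set.mem_iUnion.2 ⟨n, ?_⟩
    have := hr ((n : ℝ) + 1) (by rw [Real.norm_eq_abs, abs_of_nonneg (by positivity)]; linarith)
    exact this rfl
  obtain ⟨n, x, hx⟩ := nonempty_interior_of_iUnion_of_closed
    (fun n : ℕ => hT.isClosed.smul_of_ne_zero (by positivity : ((n : ℝ) + 1) ≠ 0)) hU
  have hn : ((n : ℝ) + 1) ≠ 0 := by positivity
  rw [interior_smul₀ hn] at hx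
  obtain ⟨y, hy, rfl⟩ := hx
  have hy' : -y ∈ interior T := by
    refine interior_mono (hT.balanced (-1) (by simp)) ?_
    rw [interior_smul₀ (by norm_num : (-1 : ℝ) ≠ 0)]
    exact ⟨y, hy, by simp⟩
  have h0 : (0 : E) ∈ interior T := by
    have := hT.convex.interior hy hy' (by norm_num : (0 : ℝ) ≤ 1 / 2)
      (by norm_num : (0 : ℝ) ≤ 1 / 2) (by norm_num)
    simpa using this
  exact mem_interior_iff_mem_nhds.1 h0

/-- A barrel of C_p(X) pulls back to a barrel of the Banach space of bounded continuous functions,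
hence contains a multiple of its unit ball. -/
theorem isBarrelBounded_unitBall : IsBarrelBounded {f : Cp X ℝ | ∀ x, |f.1 x| ≤ 1} := by
  intro T hT
  let ι : (X →ᵇ ℝ) →L[ℝ] Cp X ℝ :=
    { toFun := fun f => ⟨f, f.continuous⟩
      map_add' := fun _ _ => rfl
      map_smul' := fun _ _ => rfl
      cont := continuous_induced_rng.2 (continuous_pi fun x =>
        (BoundedContinuousFunction.evalCLM ℝ x).continuous) }
  obtain ⟨r, hr0, hr⟩ := Metric.mem_nhds_iff.1 (hT.preimage ι).mem_nhds_zero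
  refine absorbs_iff_norm.2 ⟨2 / r, fun c hc f hf => ?_⟩
  have hc0 : 0 < ‖c‖ := (by positivity : 0 < 2 / r).trans_le hc
  let g : X →ᵇ ℝ := BoundedContinuousFunction.ofNormedAddCommGroup f.1 f.2 1 hf
  have hg : ‖g‖ ≤ 1 := BoundedContinuousFunction.norm_ofNormedAddCommGroup_le _ zero_le_one _
  have hmem : c⁻¹ • g ∈ Metric.ball (0 : X →ᵇ ℝ) r := by
    rw [mem_ball_zero_iff, norm_smul, norm_inv]
    calc ‖c‖⁻¹ * ‖g‖ ≤ (2 / r)⁻¹ * 1 := by gcongr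
      _ = r / 2 := by rw [mul_one, inv_div]
      _ < r := half_lt_self hr0
  rw [Set.mem_smul_set_iff_inv_smul_mem₀ (norm_pos_iff.1 hc0)]
  exact hr hmem

theorem exists_frequently_le_of_not_tendsto {u : ℕ → ℝ} (hu : ∀ n, 0 ≤ u n)
    (h : ¬ Tendsto u atTop (𝓝 0)) : ∃ ε > 0, ∃ᶠ n in atTop, ε ≤ u n := by
  rw [Metric.tendsto_nhds] at h
  push Not at h
  obtain ⟨ε, hε, hf⟩ := h
  refine ⟨ε, hε, hf.mono fun n hn => ?_⟩
  rwa [Real.dist_eq, sub_zero, abs_of_nonneg (hu n)] at hn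

theorem HasJN.hasJNP (h : HasJN X) (hX : FunctionallyHausdorff X) : HasJNP (Cp X ℝ) := by
  obtain ⟨μ, hμ, h⟩ := h
  obtain ⟨ε, hε, hf⟩ := exists_frequently_le_of_not_tendsto (fun n => tv_nonneg _) h
  rw [hasJNP_iff]
  refine ⟨fun n => measureCLM (μ n), fun f => ?_, _, isBarrelBounded_unitBall, ε, hε,
    hf.mono fun n hn => ?_⟩
  · simpa using hμ f.1 f.2
  · obtain ⟨f, hfc, hf1, hfμ⟩ := hX.exists_norming (μ n)
    exact ⟨⟨f, hfc⟩, hf1, by simpa [hfμ, abs_of_nonneg (tv_nonneg _)] using hn⟩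

/-- If the variations tended to 0, division by their square roots would leave the functionals
pointwise null, hence bounded on B. The original functionals would then be uniformly small on B. A
zero measure does no harm, since `0⁻¹ = 0`. -/
theorem HasJNP.hasJN (h : HasJNP (Cp X ℝ)) (hX : FunctionallyHausdorff X) : HasJN X := by
  obtain ⟨φ, hφ, B, hB, ε, hε, hf⟩ := hasJNP_iff.1 h
  choose μ hμ using fun n => exists_eq_measureCLM (φ n)
  have hnull : IsNullSeq μ := fun f hf => by
    have := hφ ⟨f, hf⟩
    simpa [hμ] using this
  refine ⟨μ, hnull, fun htv => ?_⟩
  have hs : Tendsto (fun n => √(tv (μ n))) atTop (𝓝 0) := by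
    simpa using htv.sqrt
  obtain ⟨C, hC⟩ := hB.exists_bound (φ := fun n => (√(tv (μ n)))⁻¹ • φ n) (fun f => by
    obtain ⟨C, hC⟩ := hnull.exists_abs_pairing_le hX f.2
    refine squeeze_zero_norm (fun n => ?_) (by simpa using hs.const_mul C)
    have h0 := tv_nonneg (μ n)
    rw [smul_apply, hμ, measureCLM_apply, norm_smul, norm_inv,
      Real.norm_of_nonneg (Real.sqrt_nonneg _), Real.norm_eq_abs]
    calc (√(tv (μ n)))⁻¹ * |pairing f.1 (μ n)| ≤ (√(tv (μ n)))⁻¹ * (C * tv (μ n)) := by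
          gcongr
          exact hC n
      _ = C * (tv (μ n) / √(tv (μ n))) := by ring
      _ = C * √(tv (μ n)) := by rw [Real.div_sqrt])
  have hlim : Tendsto (fun n => C * √(tv (μ n))) atTop (𝓝 0) := by simpa using hs.const_mul C
  obtain ⟨n, ⟨b, hb, hle⟩, hlt⟩ := (hf.and_eventually (hlim.eventually_lt_const hε)).exists
  have hpos : 0 < √(tv (μ n)) := by
    rw [Real.sqrt_pos]
    refine (tv_nonneg _).lt_of_ne fun h0 => ?_
    rw [hμ, tv_eq_zero h0.symm] at hle
    simp at hle
    linarith
  have h1 := hC n b hb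
  rw [smul_apply, smul_eq_mul, abs_mul, abs_inv, abs_of_pos hpos,
    inv_mul_le_iff₀ hpos] at h1
  linarith [mul_comm C √(tv (μ n))]

/-- If the variations t of the coordinate measures tended to 0, the sequence √t would be the image
of some f. But that image is at most C · t, which is eventually smaller than √t. -/
theorem MapsLinearlyOnto.hasJNP (h : MapsLinearlyOnto (Cp X ℝ) C0p)
    (hX : FunctionallyHausdorff X) : HasJNP (Cp X ℝ) := by
  obtain ⟨T, hT⟩ := h
  let φ : ℕ → Cp X ℝ →L[ℝ] ℝ := fun n =>
    ((ContinuousLinearMap.proj n).comp nullSequences.subtypeL).comp T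
  choose μ hμ using fun n => exists_eq_measureCLM (φ n)
  have hval : ∀ f n, (T f).1 n = pairing f.1 (μ n) := fun f n => by
    rw [← measureCLM_apply, ← hμ]; rfl
  have hnull : IsNullSeq μ := fun f hf => by
    have := (T ⟨f, hf⟩).2
    exact this.congr fun n => hval ⟨f, hf⟩ n
  refine HasJN.hasJNP ⟨μ, hnull, fun htv => ?_⟩ hX
  have hs : Tendsto (fun n => √(tv (μ n))) atTop (𝓝 0) := by
    simpa using htv.sqrt
  obtain ⟨f, hf⟩ := hT ⟨fun n => √(tv (μ n)), hs⟩
  obtain ⟨C, hC⟩ := hnull.exists_abs_pairing_le hX f.2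
  -- A zero coordinate functional would keep the unit vector `Pi.single n 1` out of the range.
  have hpos : ∀ n, 0 < √(tv (μ n)) := by
    intro n
    rw [Real.sqrt_pos]
    refine (tv_nonneg _).lt_of_ne fun h0 => ?_
    have h1 : φ n = 0 := by
      rw [hμ, tv_eq_zero h0.symm]
      ext f
      simp
    obtain ⟨g, hg⟩ := hT ⟨Pi.single n (1 : ℝ), tendsto_const_nhds.congr' <| by
      filter_upwards [eventually_gt_atTop n] with m hm
      rw [Pi.single_eq_of_ne hm.ne']⟩
    have h2 : (T g).1 n = 0 := congrArg (fun ψ => ψ g) h1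
    simp [hg] at h2
  have hlim : Tendsto (fun n => C * √(tv (μ n))) atTop (𝓝 0) := by simpa using hs.const_mul C
  obtain ⟨n, hn⟩ := (hlim.eventually_lt_const one_pos).exists
  have h1 := hC n
  rw [← hval, hf] at h1
  have h2 := Real.mul_self_sqrt (tv_nonneg (μ n))
  have h3 := hpos n
  simp only [abs_of_pos h3] at h1
  rw [← h2, Real.sqrt_mul_self h3.le, ← mul_assoc] at h1
  nlinarith

end UnitBall

/-! ### Bump functions and disjoint neighborhoods -/

section Tychonoff

variable {X : Type*} [TopologicalSpace X]

theorem functionallyHausdorff_of_t35Space [T35Space X] : FunctionallyHausdorff X :=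
  fun _ _ hxy => separatesPoints_continuous_of_t35Space hxy

/-- Finite sets are functionally separated from closed sets. -/
theorem exists_bump_of_finset [CompletelyRegularSpace X] (t : Finset X) {U : Set X} (hU : IsOpen U)
    (htU : ↑t ⊆ U) : ∃ f : X → ℝ, Continuous f ∧ (∀ x, |f x| ≤ 1) ∧ (∀ x ∈ t, f x = 1) ∧
      ∀ x ∉ U, f x = 0 := by
  classical
  have h : ∀ x : t, ∃ f : X → ℝ, Continuous f ∧ (∀ z, f z ∈ Set.Icc (0 : ℝ) 1) ∧ f x = 0 ∧
      ∀ z ∉ U, f z = 1 := by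
    intro x
    obtain ⟨f, hf, hfx, hfU⟩ :=
      CompletelyRegularSpace.completely_regular_isOpen x.1 U hU (htU x.2)
    exact ⟨fun z => f z, continuous_subtype_val.comp hf, fun z => (f z).2, by simp [hfx],
      fun z hz => by simp [hfU hz]⟩
  choose f hf hf01 hfx hfU using h
  refine ⟨fun z => 1 - ∏ x : t, f x z,
    continuous_const.sub (continuous_finsetProd _ fun x _ => hf x), fun z => ?_, fun z hz => ?_,
    fun z hz => ?_⟩
  · have h0 : 0 ≤ ∏ x : t, f x z := Finset.prod_nonneg fun x _ => (hf01 x z).1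
    have h1 : ∏ x : t, f x z ≤ 1 :=
      Finset.prod_le_one (fun x _ => (hf01 x z).1) fun x _ => (hf01 x z).2
    rw [abs_le]
    constructor <;> linarith
  · simp only
    rw [Finset.prod_eq_zero (Finset.mem_univ ⟨z, hz⟩) (hfx ⟨z, hz⟩), sub_zero]
  · simp only
    rw [Finset.prod_eq_one fun x _ => hfU x z hz, sub_self]

/-- Except for at most one point, each point of an injective sequence has a neighborhood whose
closure misses most of the sequence. -/
theorem eventually_exists_isOpen_notMem_closure [T25Space X] {x : ℕ → X}
    (hx : Function.Injective x) :
    ∀ᶠ n in (hyperfilter ℕ : Filter ℕ), ∃ O : Set X, IsOpen O ∧ x n ∈ O ∧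
      ∀ᶠ m in (hyperfilter ℕ : Filter ℕ), x m ∉ closure O := by
  by_cases h : ∃ n, ¬ ∃ O : Set X, IsOpen O ∧ x n ∈ O ∧
      ∀ᶠ m in (hyperfilter ℕ : Filter ℕ), x m ∉ closure O
  · obtain ⟨n, hn⟩ := h
    filter_upwards [hyperfilter_le_cofinite (Set.finite_singleton n).compl_mem_cofinite] with m hm
    obtain ⟨O, hnO, hO, O', hmO', hO', hd⟩ :=
      exists_open_nhds_disjoint_closure (hx.ne (Ne.symm hm) : x n ≠ x m)
    refine ⟨O', hO', hmO', ?_⟩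
    -- If closure O' contained most terms, the disjoint set closure O would miss most of them,
    -- although `x n` is exceptional.
    by_contra hev
    rw [Ultrafilter.eventually_not, not_not] at hev
    exact hn ⟨O, hO, hnO, hev.mono fun k hk hk' => Set.disjoint_left.1 hd hk' hk⟩
  · push Not at h
    exact Eventually.of_forall h

theorem pairwise_disjoint_diff_closure (O : ℕ → Set X) : Pairwise (Function.onFun Disjoint
    fun k => O k \ ⋃ j ∈ Finset.range k, closure (O j)) :=
  (pairwise_disjoint_on _).2 fun _ _ hij => Set.disjoint_left.2 fun _ hz hz' => hz'.2 <|
    Set.mem_biUnion (Finset.mem_coe.2 (Finset.mem_range.2 hij)) (subset_closure hz.1)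

theorem IsOpen.diff_biUnion_closure {ι : Type*} {V : Set X} (hV : IsOpen V) (s : Finset ι)
    (O : ι → Set X) : IsOpen (V \ ⋃ j ∈ s, closure (O j)) :=
  hV.sdiff (Set.Finite.isClosed_biUnion (Finset.finite_toSet _) fun _ _ => isClosed_closure)

/-- Two injective sequences have simultaneous subsequences whose points have pairwise disjoint
neighborhoods. -/
theorem exists_subseq_pairwise_disjoint_nhds {Y : Type*} [TopologicalSpace Y] [T25Space X]
    [T25Space Y] {x : ℕ → X} {y : ℕ → Y} (hx : Function.Injective x) (hy : Function.Injective y) :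
    ∃ (φ : ℕ → ℕ) (U : ℕ → Set X) (V : ℕ → Set Y),
      (∀ k, IsOpen (U k) ∧ x (φ k) ∈ U k) ∧ (∀ k, IsOpen (V k) ∧ y (φ k) ∈ V k) ∧
      Pairwise (Function.onFun Disjoint U) ∧ Pairwise (Function.onFun Disjoint V) := by
  have hx' := eventually_exists_isOpen_notMem_closure hx
  have hy' := eventually_exists_isOpen_notMem_closure hy
  -- One ultrafilter serves both sequences, so a single index meets the requirements in X and in Y.
  obtain ⟨p, hp, hr⟩ := exists_seq_of_forall_finset_exists
    (fun p : ℕ × Set X × Set Y => (IsOpen p.2.1 ∧ x p.1 ∈ p.2.1 ∧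
        ∀ᶠ m in (hyperfilter ℕ : Filter ℕ), x m ∉ closure p.2.1) ∧
      (IsOpen p.2.2 ∧ y p.1 ∈ p.2.2 ∧
        ∀ᶠ m in (hyperfilter ℕ : Filter ℕ), y m ∉ closure p.2.2))
    (fun p q => x q.1 ∉ closure p.2.1 ∧ y q.1 ∉ closure p.2.2) (by
      intro s hs
      have h1 : ∀ᶠ m in (hyperfilter ℕ : Filter ℕ), ∀ p ∈ s,
          x m ∉ closure p.2.1 ∧ y m ∉ closure p.2.2 :=
        (Filter.eventually_all_finset s).2 fun p hp => (hs p hp).1.2.2.and (hs p hp).2.2.2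
      obtain ⟨n, hn, ⟨O, hO⟩, ⟨O', hO'⟩⟩ := (h1.and (hx'.and hy')).exists
      exact ⟨(n, O, O'), ⟨hO, hO'⟩, hn⟩)
  refine ⟨fun k => (p k).1, fun k => (p k).2.1 \ ⋃ j ∈ Finset.range k, closure (p j).2.1,
    fun k => (p k).2.2 \ ⋃ j ∈ Finset.range k, closure (p j).2.2,
    fun k => ⟨(hp k).1.1.diff_biUnion_closure _ _, (hp k).1.2.1, ?_⟩,
    fun k => ⟨(hp k).2.1.diff_biUnion_closure _ _, (hp k).2.2.1, ?_⟩,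
    pairwise_disjoint_diff_closure _, pairwise_disjoint_diff_closure _⟩
  · simp only [Finset.mem_range, Set.mem_iUnion, not_exists]
    exact fun j hj => (hr j k hj).1
  · simp only [Finset.mem_range, Set.mem_iUnion, not_exists]
    exact fun j hj => (hr j k hj).2

end Tychonoff

/-! ### Separately continuous functions as a C_p space -/

section SepProd

variable (X Y : Type*)

/-- The product of two spaces, with the coarsest topology that makes all separately continuous
real functions continuous. -/
def SepProd := X × Y

variable {X Y} [TopologicalSpace X] [TopologicalSpace Y]

/-- The separately continuous real functions. -/
structure IsSepContinuous (f : X × Y → ℝ) : Prop where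
  left : ∀ y, Continuous fun x => f (x, y)
  right : ∀ x, Continuous fun y => f (x, y)

instance : TopologicalSpace (SepProd X Y) :=
  ⨅ f : {f : X × Y → ℝ // IsSepContinuous f}, TopologicalSpace.induced f.1 inferInstance

/-- The inclusions of the lines are continuous, since each function defining the topology is
continuous along them. So the topology adds no new continuous real functions. -/
theorem SepProd.continuous_iff {f : SepProd X Y → ℝ} : Continuous f ↔ IsSepContinuous (X := X) f := by
  constructor
  · intro h
    constructor
    · intro y
      refine h.comp (continuous_iInf_rng.2 fun g => continuous_induced_rng.2 (g.2.left y))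
    · intro x
      refine h.comp (continuous_iInf_rng.2 fun g => continuous_induced_rng.2 (g.2.right x))
  · intro h
    exact continuous_iInf_dom (i := (⟨f, h⟩ : {f : X × Y → ℝ // IsSepContinuous f}))
      continuous_induced_dom

theorem IsSepContinuous.mul_of_continuous {u : X → ℝ} {v : Y → ℝ} (hu : Continuous u)
    (hv : Continuous v) : IsSepContinuous fun z : X × Y => u z.1 * v z.2 :=
  ⟨fun y => hu.mul (continuous_const (y := v y)),
    fun x => (continuous_const (y := u x)).mul hv⟩

theorem SepProd.functionallyHausdorff (hX : FunctionallyHausdorff X)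
    (hY : FunctionallyHausdorff Y) : FunctionallyHausdorff (SepProd X Y) := by
  rintro ⟨x, y⟩ ⟨x', y'⟩ hne
  by_cases hx : x = x'
  · subst hx
    obtain ⟨g, hg, hgy⟩ := hY y y' (fun h => hne (by rw [h]))
    exact ⟨fun z => g z.2, SepProd.continuous_iff.2 ⟨fun y => continuous_const (y := g y), fun _ => hg⟩, hgy⟩
  · obtain ⟨g, hg, hgx⟩ := hX x x' hx
    exact ⟨fun z => g z.1, SepProd.continuous_iff.2 ⟨fun _ => hg, fun x => continuous_const (y := g x)⟩, hgx⟩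

/-- `C_p(X, C_p(Y))` is the space of separately continuous functions on `X × Y`. -/
noncomputable def cpCpEquiv : Cp X (Cp Y ℝ) ≃L[ℝ] Cp (SepProd X Y) ℝ where
  toFun F := ⟨fun z => (F.1 z.1).1 z.2, SepProd.continuous_iff.2
    ⟨fun y => (continuous_apply y).comp (continuous_subtype_val.comp F.2), fun x => (F.1 x).2⟩⟩
  map_add' _ _ := rfl
  map_smul' _ _ := rfl
  invFun f := ⟨fun x => ⟨fun y => f.1 (x, y), (SepProd.continuous_iff.1 f.2).right x⟩,
    continuous_induced_rng.2 (continuous_pi fun y => (SepProd.continuous_iff.1 f.2).left y)⟩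
  left_inv _ := rfl
  right_inv _ := rfl
  continuous_toFun := continuous_induced_rng.2 (continuous_pi fun z =>
    (continuous_apply z.2).comp (continuous_subtype_val.comp
      ((continuous_apply z.1).comp continuous_subtype_val)))
  continuous_invFun := continuous_induced_rng.2 (continuous_pi fun x =>
    continuous_induced_rng.2 (continuous_pi fun y =>
      (continuous_apply ((x, y) : SepProd X Y)).comp continuous_subtype_val))

/-- A set on which all separately continuous functions are bounded is covered by finitely many
vertical and horizontal lines. -/
theorem exists_finset_cover_of_bounded [T35Space X] [T35Space Y] {S : Set (X × Y)}
    (hS : ∀ f : X × Y → ℝ, IsSepContinuous f → ∃ C, ∀ z ∈ S, |f z| ≤ C) :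
    ∃ (A : Finset X) (B : Finset Y), ∀ z ∈ S, z.1 ∈ A ∨ z.2 ∈ B := by
  classical
  by_contra! hcov
  obtain ⟨p, hp, hr⟩ := exists_seq_of_forall_finset_exists (fun z => z ∈ S)
    (fun z w : X × Y => z.1 ≠ w.1 ∧ z.2 ≠ w.2) (by
      intro s _
      obtain ⟨z, hz, h1, h2⟩ := hcov (s.image Prod.fst) (s.image Prod.snd)
      exact ⟨z, hz, fun w hw => ⟨fun h => h1 (h ▸ Finset.mem_image_of_mem _ hw),
        fun h => h2 (h ▸ Finset.mem_image_of_mem _ hw)⟩⟩)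
  have hinj1 : Function.Injective fun k => (p k).1 :=
    Function.Injective.of_lt_imp_ne fun i j hij => (hr i j hij).1
  have hinj2 : Function.Injective fun k => (p k).2 :=
    Function.Injective.of_lt_imp_ne fun i j hij => (hr i j hij).2
  obtain ⟨φ, U, V, hU, hV, hUd, hVd⟩ := exists_subseq_pairwise_disjoint_nhds hinj1 hinj2
  choose f hf _ hf1 hf0 using fun k => exists_bump_of_finset {(p (φ k)).1} (hU k).1
    (by simpa using (hU k).2)
  choose g hg _ hg1 hg0 using fun k => exists_bump_of_finset {(p (φ k)).2} (hV k).1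
    (by simpa using (hV k).2)
  -- On each line at most one summand is nonzero, which gives separate continuity; at the k-th
  -- chosen point of S the value is k.
  let F : X × Y → ℝ := fun z => ∑ᶠ k : ℕ, k * f k z.1 * g k z.2
  have hFU : ∀ i x y, x ∈ U i → F (x, y) = i * f i x * g i y := by
    intro i x y hx
    refine finsum_eq_single _ i fun k hk => ?_
    rw [hf0 k x (fun h => Set.disjoint_left.1 (hUd hk) h hx), mul_zero, zero_mul]
  have hFV : ∀ i x y, y ∈ V i → F (x, y) = i * f i x * g i y := by
    intro i x y hy
    refine finsum_eq_single _ i fun k hk => ?_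
    rw [hg0 k y (fun h => Set.disjoint_left.1 (hVd hk) h hy), mul_zero]
  have hF : IsSepContinuous F := by
    constructor
    · intro y
      by_cases hy : ∃ i, y ∈ V i
      · obtain ⟨i, hi⟩ := hy
        simp only [hFV i _ y hi]
        exact (continuous_const.mul (hf i)).mul continuous_const
      · push Not at hy
        have : ∀ x, F (x, y) = 0 := fun x => by
          simp [F, fun k => hg0 k y (hy k)]
        simp only [this]
        exact continuous_const
    · intro x
      by_cases hx : ∃ i, x ∈ U i
      · obtain ⟨i, hi⟩ := hx
        simp only [hFU i x _ hi]
        exact continuous_const.mul (hg i)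
      · push Not at hx
        have : ∀ y, F (x, y) = 0 := fun y => by
          simp [F, fun k => hf0 k x (hx k)]
        simp only [this]
        exact continuous_const
  obtain ⟨C, hC⟩ := hS F hF
  obtain ⟨k, hk⟩ := exists_nat_gt C
  have h1 := hC _ (hp (φ k))
  rw [show F (p (φ k)) = k by
    rw [show p (φ k) = ((p (φ k)).1, (p (φ k)).2) from rfl, hFU k _ _ (hU k).2,
      hf1 k _ (Finset.mem_singleton_self _), hg1 k _ (Finset.mem_singleton_self _)]
    simp] at h1
  linarith [le_abs_self (k : ℝ)]

end SepProd

/-! ### Weighted push-forwards and grid points -/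

section Pushforward

variable {Z W : Type*}

/-- The image under `p` of the measure `μ` with density `u`. -/
noncomputable def pushWeighted (p : Z → W) (u : Z → ℝ) (μ : Z →₀ ℝ) : W →₀ ℝ :=
  ∑ z ∈ μ.support, Finsupp.single (p z) (μ z * u z)

theorem pairing_pushWeighted (p : Z → W) (u : Z → ℝ) (μ : Z →₀ ℝ) (h : W → ℝ) :
    pairing h (pushWeighted p u μ) = pairing (fun z => u z * h (p z)) μ := by
  rw [pushWeighted, map_sum, pairing_eq_sum (μ := μ) subset_rfl]
  refine Finset.sum_congr rfl fun z _ => ?_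
  rw [pairing, Finsupp.linearCombination_single, smul_eq_mul, mul_assoc]

/-- If the density is `1` on `R`, the projection is injective on `R` and the rest of the measure is
either projected elsewhere or has density `0`, then the push-forward keeps the variation on `R`. -/
theorem mass_le_tv_pushWeighted {p : Z → W} {u : Z → ℝ} {μ : Z →₀ ℝ} {R : Set Z} {q : W → Z}
    (hq : ∀ z ∈ R, q (p z) = z) (hu : ∀ z ∈ R, u z = 1)
    (h0 : ∀ z ∈ μ.support, z ∉ R → q (p z) ∈ R → u z = 0) :
    mass μ R ≤ tv (pushWeighted p u μ) := by
  classical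
  -- The sign of μ on R, carried to W by the section q, is a test function recovering the variation
  -- on R.
  let s : W → ℝ := fun w => if q w ∈ R then SignType.sign (μ (q w)) else 0
  have hs : ∀ w, |s w| ≤ 1 := by
    intro w
    by_cases hw : q w ∈ R
    · rcases lt_trichotomy (μ (q w)) 0 with h | h | h <;> simp [s, hw, h]
    · simp [s, hw]
  have hval : pairing s (pushWeighted p u μ) = mass μ R := by
    rw [pairing_pushWeighted, pairing_eq_sum subset_rfl, mass]
    refine Finset.sum_congr rfl fun z hz => ?_
    by_cases hzR : z ∈ R
    · simp only [s, hq z hzR, if_pos hzR, hu z hzR, Set.indicator_of_mem hzR, one_mul]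
      rw [mul_comm, sign_mul_self]
    · rw [Set.indicator_of_notMem hzR]
      by_cases hw : q (p z) ∈ R
      · rw [h0 z hz hzR hw, zero_mul, mul_zero]
      · simp [s, hw]
  have := abs_pairing_le_tv (μ := pushWeighted p u μ) (C := 1) (fun w _ => hs w)
  rw [hval, one_mul] at this
  exact (le_abs_self _).trans this

theorem tv_le_mass {μ : Z →₀ ℝ} {A : Set Z} (h : ↑μ.support ⊆ A) : tv μ ≤ mass μ A :=
  Finset.sum_le_sum fun z hz => by
    rw [Set.indicator_of_mem (Set.mem_univ z), Set.indicator_of_mem (h hz)]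

/-- On the support, u ⊗ v differs from the indicator of (a, b) only on the part of the line x = a
outside B and the part of the line y = b outside A, and there by at most 1. -/
theorem abs_apply_le_of_cover {X Y : Type*} [DecidableEq X] [DecidableEq Y] {μ : X × Y →₀ ℝ}
    {A : Finset X} {B : Finset Y} (hsupp : ∀ z ∈ μ.support, z.1 ∈ A ∨ z.2 ∈ B) {a : X} {b : Y}
    {u : X → ℝ} {v : Y → ℝ} (hu1 : ∀ x, |u x| ≤ 1) (hv1 : ∀ y, |v y| ≤ 1)
    (hus : ∀ x ∈ A, u x = if x = a then 1 else 0) (hvs : ∀ y ∈ B, v y = if y = b then 1 else 0)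
    (ha : a ∈ A) (hb : b ∈ B) :
    |μ (a, b)| ≤ |pairing (fun z : X × Y => u z.1 * v z.2) μ| +
      (mass μ {z | z.1 = a ∧ z.2 ∉ B} + mass μ {z | z.1 ∉ A ∧ z.2 = b}) := by
  let w : X × Y → ℝ := fun z => u z.1 * v z.2
  let d : X × Y → ℝ := fun z => if z = (a, b) then 1 else 0
  have hd : pairing d μ = μ (a, b) := by
    rw [pairing_eq_sum (Finset.subset_insert ((a, b) : X × Y) _),
      Finset.sum_eq_single_of_mem (a, b) (Finset.mem_insert_self _ _)]
    · simp [d]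
    · intro z _ hz
      simp [d, hz]
  have hua : u a = 1 := by simp [hus a ha]
  have hvb : v b = 1 := by simp [hvs b hb]
  have hdiff : |pairing (w - d) μ| ≤
      1 * mass μ ({z | z.1 = a ∧ z.2 ∉ B} ∪ {z | z.1 ∉ A ∧ z.2 = b}) := by
    refine abs_pairing_le_mass ?_ ?_
    · intro z _
      by_cases hz : z = (a, b)
      · simp [w, d, hz, hua, hvb]
      · simp only [Pi.sub_apply, w, d, if_neg hz, sub_zero, abs_mul]
        exact mul_le_one₀ (hu1 _) (abs_nonneg _) (hv1 _)
    · rintro ⟨x, y⟩ hz hzR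
      rw [Set.mem_union, not_or] at hzR
      by_cases hyB : y ∈ B
      · by_cases hyb : y = b
        · have hxA : x ∈ A := by_contra fun h => hzR.2 ⟨h, hyb⟩
          by_cases hxa : x = a
          · simp [w, d, hxa, hyb, hua, hvb]
          · have : ((x, y) : X × Y) ≠ (a, b) := fun h => hxa (congrArg Prod.fst h)
            simp only [Pi.sub_apply, w, d, hus x hxA, if_neg hxa]
            rw [if_neg this]; simp
        · have : ((x, y) : X × Y) ≠ (a, b) := fun h => hyb (congrArg Prod.snd h)
          simp only [Pi.sub_apply, w, d, hvs y hyB, if_neg hyb]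
          rw [if_neg this]; simp
      · have hxA : x ∈ A := (hsupp _ hz).resolve_right hyB
        have hxa : x ≠ a := fun h => hzR.1 ⟨h, hyB⟩
        have : ((x, y) : X × Y) ≠ (a, b) := fun h => hxa (congrArg Prod.fst h)
        simp only [Pi.sub_apply, w, d, hus x hxA, if_neg hxa]
        rw [if_neg this]; simp
  have hsub : pairing (w - d) μ = pairing w μ - μ (a, b) := by
    rw [← hd]
    simp only [pairing_eq_sum (μ := μ) subset_rfl, Pi.sub_apply, mul_sub,
      Finset.sum_sub_distrib]
  rw [one_mul, hsub] at hdiff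
  have h1 := mass_union_le μ {z | z.1 = a ∧ z.2 ∉ B} {z | z.1 ∉ A ∧ z.2 = b}
  have h2 := abs_sub_abs_le_abs_sub (μ (a, b)) (pairing w μ)
  rw [abs_sub_comm] at h2
  change |μ (a, b)| ≤ |pairing w μ| + _
  linarith

end Pushforward

/-! ### From the product to a factor -/

section ProductJN

variable {X Y : Type*} [TopologicalSpace X] [TopologicalSpace Y]

/-- The supports split into line parts `R a` and `C b` and the finite grid A × B. If neither factor
had such a sequence, projections would force the variation on the line parts to 0; products u ⊗ v
then handle the grid points. -/
theorem HasJN.of_sepProd [T35Space X] [T35Space Y] (h : HasJN (SepProd X Y)) :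
    HasJN X ∨ HasJN Y := by
  classical
  have hX : FunctionallyHausdorff X := functionallyHausdorff_of_t35Space
  have hY : FunctionallyHausdorff Y := functionallyHausdorff_of_t35Space
  obtain ⟨μ, hμ, hn⟩ := h
  by_contra hno
  rw [not_or] at hno
  have hNX : ∀ ν : ℕ → X →₀ ℝ, IsNullSeq ν → Tendsto (fun n => tv (ν n)) atTop (𝓝 0) :=
    fun ν hν => by_contra fun h => hno.1 ⟨ν, hν, h⟩
  have hNY : ∀ ν : ℕ → Y →₀ ℝ, IsNullSeq ν → Tendsto (fun n => tv (ν n)) atTop (𝓝 0) :=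
    fun ν hν => by_contra fun h => hno.2 ⟨ν, hν, h⟩
  obtain ⟨A, B, hcov⟩ := exists_finset_cover_of_bounded (X := X) (Y := Y)
    (S := {z | ∃ n, z ∈ (μ n).support}) (fun f hf => by
      obtain ⟨C, hC⟩ := hμ.exists_bound_on_supports (SepProd.functionallyHausdorff hX hY)
        (SepProd.continuous_iff.2 hf)
      exact ⟨C, fun z ⟨n, hz⟩ => hC n z hz⟩)
  have hsupp : ∀ n, ∀ z ∈ (μ n).support, z.1 ∈ A ∨ z.2 ∈ B := fun n z hz => hcov z ⟨n, hz⟩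
  choose u hu hu1 hus using fun a : X => hX.exists_interpolation A
    (g := fun x => if x = a then 1 else 0) (fun x _ => by split_ifs <;> simp)
  choose v hv hv1 hvs using fun b : Y => hY.exists_interpolation B
    (g := fun y => if y = b then 1 else 0) (fun y _ => by split_ifs <;> simp)
  let R : X → Set (SepProd X Y) := fun a => {z | z.1 = a ∧ z.2 ∉ B}
  let C : Y → Set (SepProd X Y) := fun b => {z | z.1 ∉ A ∧ z.2 = b}
  -- The weight `u a` is 1 on the line x = a and kills the other lines over A, so nothing cancels `R
  -- a` when projecting to Y.
  have hR : ∀ a ∈ A, Tendsto (fun n => mass (μ n) (R a)) atTop (𝓝 0) := by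
    intro a ha
    refine squeeze_zero (fun n => mass_nonneg _ _) (fun n => ?_)
      (hNY (fun n => pushWeighted (fun z : SepProd X Y => z.2) (fun z => u a z.1) (μ n)) fun f hf => ?_)
    · refine mass_le_tv_pushWeighted (q := fun y => ((a, y) : SepProd X Y)) ?_ ?_ ?_
      · rintro ⟨x, y⟩ ⟨rfl, _⟩
        rfl
      · rintro ⟨x, y⟩ ⟨rfl, _⟩
        simp [hus x x ha]
      · rintro ⟨x, y⟩ hz hzR ⟨_, hyB⟩
        have hxA : x ∈ A := (hsupp n _ hz).resolve_right hyB
        have hxa : x ≠ a := fun h => hzR ⟨h, hyB⟩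
        simp [hus a x hxA, hxa]
    · simp only [pairing_pushWeighted]
      exact hμ _ (SepProd.continuous_iff.2 (IsSepContinuous.mul_of_continuous (hu a) hf))
  have hC : ∀ b ∈ B, Tendsto (fun n => mass (μ n) (C b)) atTop (𝓝 0) := by
    intro b hb
    refine squeeze_zero (fun n => mass_nonneg _ _) (fun n => ?_)
      (hNX (fun n => pushWeighted (fun z : SepProd X Y => z.1) (fun z => v b z.2) (μ n)) fun f hf => ?_)
    · refine mass_le_tv_pushWeighted (q := fun x => ((x, b) : SepProd X Y)) ?_ ?_ ?_
      · rintro ⟨x, y⟩ ⟨_, rfl⟩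
        rfl
      · rintro ⟨x, y⟩ ⟨_, rfl⟩
        simp [hvs y y hb]
      · rintro ⟨x, y⟩ hz hzR ⟨hxA, _⟩
        have hyB : y ∈ B := (hsupp n _ hz).resolve_left hxA
        have hyb : y ≠ b := fun h => hzR ⟨hxA, h⟩
        simp [hvs b y hyB, hyb]
    · simp only [pairing_pushWeighted]
      refine hμ _ (SepProd.continuous_iff.2 ?_)
      exact ⟨fun y => (continuous_const (y := v b y)).mul hf,
        fun x => (hv b).mul (continuous_const (y := f x))⟩
  have hP : ∀ z ∈ A ×ˢ B, Tendsto (fun n => mass (μ n) {z}) atTop (𝓝 0) := by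
    rintro ⟨a, b⟩ hab
    obtain ⟨ha, hb⟩ := Finset.mem_product.1 hab
    have hlim : Tendsto (fun n => |pairing (fun z : SepProd X Y => u a z.1 * v b z.2) (μ n)| +
        (mass (μ n) (R a) + mass (μ n) (C b))) atTop (𝓝 0) := by
      have h := (hμ _ (SepProd.continuous_iff.2
        (IsSepContinuous.mul_of_continuous (hu a) (hv b)))).abs.add ((hR a ha).add (hC b hb))
      rw [abs_zero, add_zero, add_zero] at h
      exact h
    refine squeeze_zero (fun n => mass_nonneg _ _) (fun n => ?_) hlim
    refine (mass_singleton (μ n) ((a, b) : SepProd X Y)).le.trans ?_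
    exact abs_apply_le_of_cover (hsupp n) (hu1 a) (hv1 b) (fun x hx => hus a x hx)
      (fun y hy => hvs b y hy) ha hb
  refine hn (squeeze_zero (fun n => tv_nonneg _) (g := fun n => ∑ a ∈ A, mass (μ n) (R a) +
    (∑ b ∈ B, mass (μ n) (C b) + ∑ z ∈ A ×ˢ B, mass (μ n) {z})) (fun n => ?_) ?_)
  · calc tv (μ n) ≤ mass (μ n) ((⋃ a ∈ A, R a) ∪ ((⋃ b ∈ B, C b) ∪ ⋃ z ∈ A ×ˢ B, {z})) := by
          refine tv_le_mass ?_
          rintro ⟨x, y⟩ hz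
          have h := hsupp n _ hz
          by_cases hyB : y ∈ B
          · right
            by_cases hxA : x ∈ A
            · right
              exact Set.mem_biUnion (Finset.mem_coe.2 (Finset.mk_mem_product hxA hyB)) rfl
            · left
              exact Set.mem_biUnion (Finset.mem_coe.2 hyB) ⟨hxA, rfl⟩
          · left
            exact Set.mem_biUnion (Finset.mem_coe.2 (h.resolve_right hyB)) ⟨rfl, hyB⟩
      _ ≤ _ := by
          refine (mass_union_le _ _ _).trans (add_le_add (mass_biUnion_le _ _ _) ?_)
          exact (mass_union_le _ _ _).trans
            (add_le_add (mass_biUnion_le _ _ _) (mass_biUnion_le _ _ _))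
  · have h := (tendsto_finsetSum A fun a ha => hR a ha).add
      ((tendsto_finsetSum B fun b hb => hC b hb).add (tendsto_finsetSum (A ×ˢ B) fun z hz => hP z hz))
    simpa using h

end ProductJN

/-! ### Complemented copies as pairs of maps with T ∘ S = id -/

section ComplementedCopies

variable {E F G : Type*} [AddCommGroup E] [Module ℝ E] [TopologicalSpace E]
  [AddCommGroup F] [Module ℝ F] [TopologicalSpace F]
  [AddCommGroup G] [Module ℝ G] [TopologicalSpace G]

/-- A continuous linear map with a continuous linear right inverse splits off its range. -/
theorem ContainsComplementedCopy.of_comp_eq_id [T2Space E] [T1Space F] (S : F →L[ℝ] E)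
    (T : E →L[ℝ] F) (h : ∀ x, T (S x) = x) : ContainsComplementedCopy E F := by
  have hmem : ∀ e, e ∈ S.range ↔ S (T e) = e := fun e =>
    ⟨by rintro ⟨x, rfl⟩; exact congrArg S (h x), fun he => ⟨T e, he⟩⟩
  have hc : IsCompl S.range T.ker := by
    refine IsCompl.of_eq ?_ ?_
    · rw [Submodule.eq_bot_iff]
      rintro e ⟨he, hk⟩
      rw [← (hmem e).1 he, show T e = 0 from hk, map_zero]
    · rw [Submodule.eq_top_iff']
      intro e
      rw [← add_sub_cancel (S (T e)) e]
      exact Submodule.add_mem_sup ⟨T e, rfl⟩ (show T _ = 0 by rw [map_sub, h, sub_self])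
  refine ⟨S.range, T.ker, ?_, ?_, ⟨?_⟩, hc, ?_⟩
  · have : (S.range : Set E) = {e | S (T e) = e} := Set.ext hmem
    rw [this]
    exact isClosed_eq (S.continuous.comp T.continuous) continuous_id
  · exact isClosed_singleton.preimage T.continuous
  · exact
      { toFun := fun e => T e
        map_add' := by simp
        map_smul' := by simp
        invFun := fun x => ⟨S x, x, rfl⟩
        left_inv := fun e => Subtype.ext ((hmem e).1 e.2)
        right_inv := h
        continuous_toFun := T.continuous.comp continuous_subtype_val
        continuous_invFun := S.continuous.subtype_mk _ }
  · refine continuous_induced_rng.2 ((S.continuous.comp T.continuous).congr fun e => ?_)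
    have h1 : S.range.projectionOnto T.ker hc (S (T e)) = ⟨S (T e), T e, rfl⟩ :=
      Submodule.projectionOnto_apply_left hc ⟨S (T e), T e, rfl⟩
    have h2 : S.range.projectionOnto T.ker hc (e - S (T e)) = 0 :=
      (Submodule.projectionOnto_apply_eq_zero_iff hc).2
        (show T _ = 0 by rw [map_sub, h, sub_self])
    have h3 := congrArg (S.range.projectionOnto T.ker hc) (add_sub_cancel (S (T e)) e)
    rw [map_add, h1, h2, add_zero] at h3
    exact congrArg Subtype.val h3

theorem ContainsComplementedCopy.exists_comp_eq_id (h : ContainsComplementedCopy E F) :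
    ∃ (S : F →L[ℝ] E) (T : E →L[ℝ] F), ∀ x, T (S x) = x := by
  obtain ⟨E₁, E₂, _, _, ⟨φ⟩, hc, hcont⟩ := h
  refine ⟨E₁.subtypeL.comp (φ.symm : F →L[ℝ] E₁),
    (φ : E₁ →L[ℝ] F).comp ⟨E₁.projectionOnto E₂ hc, hcont⟩, fun x => ?_⟩
  change φ (E₁.projectionOnto E₂ hc (φ.symm x : E₁)) = x
  rw [Submodule.projectionOnto_apply_left, φ.apply_symm_apply]

theorem ContainsComplementedCopy.mapsLinearlyOnto (h : ContainsComplementedCopy E F) :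
    MapsLinearlyOnto E F := by
  obtain ⟨S, T, hTS⟩ := h.exists_comp_eq_id
  exact ⟨T, fun x => ⟨S x, hTS x⟩⟩

theorem ContainsComplementedCopy.trans_of_comp_eq_id [T2Space E] [T1Space G]
    (h : ContainsComplementedCopy F G) (S : F →L[ℝ] E) (T : E →L[ℝ] F) (hTS : ∀ x, T (S x) = x) :
    ContainsComplementedCopy E G := by
  obtain ⟨S', T', h'⟩ := h.exists_comp_eq_id
  exact .of_comp_eq_id (S.comp S') (T'.comp T) fun x => by simp [hTS, h']

end ComplementedCopies

/-! ### Concentrating a null sequence on disjoint open sets -/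

theorem exists_subseq_pointwise_tendsto {X : Type*} {ν : ℕ → X →₀ ℝ} (h : ∀ n, tv (ν n) ≤ 1) :
    ∃ φ : ℕ → ℕ, StrictMono φ ∧ ∀ x, ∃ l, Tendsto (fun n => ν (φ n) x) atTop (𝓝 l) := by
  let S : Set X := ⋃ n, ↑(ν n).support
  have hS : Countable S := (Set.countable_iUnion fun n => (ν n).support.countable_toSet).to_subtype
  have hK : IsCompact (Set.univ.pi fun _ : S => Set.Icc (-1 : ℝ) 1) :=
    isCompact_univ_pi fun _ => isCompact_Icc
  -- Only countably many points carry mass, so the cube is metrizable and sequentially compact.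
  obtain ⟨l, _, φ, hφ, hl⟩ := hK.tendsto_subseq (x := fun n (s : S) => ν n s) (fun n s _ =>
    abs_le.1 ((abs_apply_le_tv _ _).trans (h n)))
  refine ⟨φ, hφ, fun x => ?_⟩
  by_cases hx : x ∈ S
  · exact ⟨l ⟨x, hx⟩, (tendsto_pi_nhds.1 hl) ⟨x, hx⟩⟩
  · refine ⟨0, tendsto_const_nhds.congr fun n => ?_⟩
    rw [Finsupp.notMem_support_iff.1 fun hn => hx (Set.mem_iUnion.2 ⟨φ n, hn⟩)]

section NullSequences

variable {X : Type*} [TopologicalSpace X]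

theorem IsNullSeq.comp {μ : ℕ → X →₀ ℝ} (hμ : IsNullSeq μ) {φ : ℕ → ℕ} (hφ : Tendsto φ atTop atTop) :
    IsNullSeq (μ ∘ φ) := fun f hf => (hμ f hf).comp hφ

theorem HasJN.exists_tv_eq_one (h : HasJN X) :
    ∃ ν : ℕ → X →₀ ℝ, IsNullSeq ν ∧ ∀ n, tv (ν n) = 1 := by
  obtain ⟨μ, hμ, hn⟩ := h
  obtain ⟨ε, hε, hf⟩ := exists_frequently_le_of_not_tendsto (fun n => tv_nonneg _) hn
  obtain ⟨φ, hφ, hle⟩ := extraction_of_frequently_atTop hf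
  have hpos : ∀ n, 0 < tv (μ (φ n)) := fun n => hε.trans_le (hle n)
  refine ⟨fun n => (tv (μ (φ n)))⁻¹ • μ (φ n), fun f hf => ?_, fun n => ?_⟩
  · have h0 : Tendsto (fun n => ε⁻¹ * |pairing f (μ (φ n))|) atTop (𝓝 0) := by
      simpa using ((hμ f hf).comp hφ.tendsto_atTop).abs.const_mul ε⁻¹
    refine squeeze_zero_norm (fun n => ?_) h0
    rw [map_smul, norm_smul, Real.norm_eq_abs, Real.norm_eq_abs, abs_inv, abs_of_pos (hpos n)]
    gcongr
    exact hle n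
  · rw [tv_smul, abs_inv, abs_of_pos (hpos n), inv_mul_cancel₀ (hpos n).ne']

/-- From a normalized null sequence one obtains a null sequence, bounded away from zero in
variation, whose values at every point tend to zero. -/
theorem HasJN.exists_pointwise_null (hX : FunctionallyHausdorff X) (h : HasJN X) :
    ∃ ν : ℕ → X →₀ ℝ, IsNullSeq ν ∧ (∀ n, 1 / 4 ≤ tv (ν n)) ∧ (∀ n, tv (ν n) ≤ 2) ∧
      ∀ x, Tendsto (fun n => ν n x) atTop (𝓝 0) := by
  obtain ⟨μ, hμ, hμ1⟩ := h.exists_tv_eq_one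
  obtain ⟨φ, hφ, hl⟩ := exists_subseq_pointwise_tendsto fun n => (hμ1 n).le
  have hν := hμ.comp hφ.tendsto_atTop
  set ν := μ ∘ φ
  have hν1 : ∀ n, tv (ν n) = 1 := fun n => hμ1 _
  -- A function norming `ν N` has integral 1 against `ν N` but small integrals against late terms,
  -- so late terms stay far from `ν N` in variation.
  have key : ∀ N, ∃ n ≥ N, 1 / 4 ≤ tv (ν n - ν N) := by
    intro N
    by_contra! hlt
    obtain ⟨f, hf, hf1, hfN⟩ := hX.exists_norming (ν N)
    obtain ⟨n, hn, hnN⟩ := (((hν f hf).eventually_lt_const (by norm_num : (0 : ℝ) < 1 / 2)).and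
      (eventually_ge_atTop N)).exists
    have h1 := abs_pairing_le_tv (μ := ν n - ν N) (C := 1) (fun x _ => hf1 x)
    rw [map_sub, hfN, hν1, one_mul] at h1
    have h2 := hlt n hnN
    have h3 := neg_abs_le (pairing f (ν n) - 1)
    linarith
  choose g hg hgtv using key
  have hgt : Tendsto g atTop atTop := tendsto_atTop_mono hg tendsto_id
  -- Differences cancel the common pointwise limit, which itself need not be 0.
  refine ⟨fun N => ν (g N) - ν N, fun f hf => ?_, hgtv, fun n => ?_, fun x => ?_⟩
  · simpa using ((hν f hf).comp hgt).sub (hν f hf)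
  · have := tv_sub_le (ν (g n)) (ν n)
    rw [hν1, hν1] at this
    linarith
  · obtain ⟨l, hl⟩ := hl x
    have := (hl.comp hgt).sub hl
    rw [sub_self] at this
    exact this

/-- Along an ultrafilter, bounded measures give small mass to a neighborhood of any finite set that
avoids finitely many exceptional points. -/
theorem exists_finset_forall_exists_isOpen_mass_lt [T2Space X] {ν : ℕ → X →₀ ℝ} {C : ℝ}
    (hC : ∀ n, tv (ν n) ≤ C) (l : Ultrafilter ℕ) {ε : ℝ} (hε : 0 < ε) :
    ∃ Q : Finset X, ∀ t : Finset X, Disjoint t Q → ∃ W : Set X, IsOpen W ∧ ↑t ⊆ W ∧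
      ∀ᶠ n in (l : Filter ℕ), mass (ν n) W < ε := by
  have hlim : ∀ A : Set X, ∃ m, Tendsto (fun n => mass (ν n) A) l (𝓝 m) := by
    intro A
    obtain ⟨m, _, hm⟩ := (isCompact_Icc (a := (0 : ℝ)) (b := C)).ultrafilter_le_nhds
      (l.map fun n => mass (ν n) A) (by
        rw [le_principal_iff, Ultrafilter.coe_map, mem_map]
        exact Eventually.of_forall fun n => ⟨mass_nonneg _ _, (mass_le_tv _ _).trans (hC n)⟩)
    exact ⟨m, hm⟩
  choose m hm using hlim
  have hm0 : ∀ A, 0 ≤ m A := fun A => ge_of_tendsto' (hm A) fun n => mass_nonneg _ _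
  let N : X → Set ℝ := fun x => m '' {U | IsOpen U ∧ x ∈ U}
  have hNne : ∀ x, (N x).Nonempty := fun x => ⟨_, Set.univ, ⟨isOpen_univ, trivial⟩, rfl⟩
  have hNbdd : ∀ x, BddBelow (N x) := fun x => ⟨0, by rintro _ ⟨U, _, rfl⟩; exact hm0 U⟩
  -- q x is the limit mass that no neighborhood of x can avoid. Disjoint neighborhoods bound the
  -- finite sums of q by C, so q is summable and Q carries all but a small tail.
  let q : X → ℝ := fun x => sInf (N x)
  have hq0 : ∀ x, 0 ≤ q x := fun x =>
    le_csInf (hNne x) (by rintro _ ⟨U, _, rfl⟩; exact hm0 U)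
  have hqsum : Summable q := by
    refine summable_of_sum_le (c := C) hq0 fun t => ?_
    obtain ⟨U, hU, hd⟩ := t.finite_toSet.t2_separation
    calc ∑ x ∈ t, q x ≤ ∑ x ∈ t, m (U x) := Finset.sum_le_sum fun x _ =>
          csInf_le (hNbdd x) ⟨U x, ⟨(hU x).2, (hU x).1⟩, rfl⟩
      _ ≤ C := le_of_tendsto' (tendsto_finsetSum t fun x _ => hm (U x))
          fun n => (sum_mass_le_tv _ _ _ hd).trans (hC n)
  obtain ⟨Q, hQ⟩ := summable_iff_vanishing_norm.1 hqsum (ε / 2) (by positivity)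
  refine ⟨Q, fun t ht => ?_⟩
  have hδ : 0 < ε / 2 / (t.card + 1) := by positivity
  have hex : ∀ x, ∃ U : Set X, IsOpen U ∧ x ∈ U ∧ m U < q x + ε / 2 / (t.card + 1) := by
    intro x
    obtain ⟨_, ⟨U, hU, rfl⟩, hlt⟩ :=
      exists_lt_of_csInf_lt (hNne x) (lt_add_of_pos_right (q x) hδ)
    exact ⟨U, hU.1, hU.2, hlt⟩
  choose U hU hxU hUm using hex
  refine ⟨⋃ x ∈ t, U x, isOpen_biUnion fun x _ => hU x,
    fun x hx => Set.mem_biUnion hx (hxU x), ?_⟩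
  have h1 : ∑ x ∈ t, m (U x) < ε := by
    have h2 : ∑ x ∈ t, q x < ε / 2 := (le_abs_self _).trans_lt (hQ t ht)
    have h3 : ∑ x ∈ t, m (U x) ≤ ∑ x ∈ t, (q x + ε / 2 / (t.card + 1)) :=
      Finset.sum_le_sum fun x _ => (hUm x).le
    rw [Finset.sum_add_distrib, Finset.sum_const, nsmul_eq_mul] at h3
    have h4 : (t.card : ℝ) * (ε / 2 / (t.card + 1)) ≤ ε / 2 := by
      rw [mul_div_assoc', div_le_iff₀ (by positivity)]
      nlinarith
    linarith
  exact ((tendsto_finsetSum t fun x _ => hm (U x)).eventually_lt_const h1).mono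
    fun n hn => (mass_biUnion_le _ _ _).trans_lt hn

theorem sum_range_half_pow_lt (i k : ℕ) :
    ∑ j ∈ Finset.range i, (1 / 2 : ℝ) ^ (j + (k + 1)) < (1 / 2) ^ k := by
  have h : ∑ j ∈ Finset.range i, (1 / 2 : ℝ) ^ (j + (k + 1)) = (1 / 2) ^ k - (1 / 2) ^ (i + k) := by
    induction i with
    | zero => simp
    | succ i ih =>
      rw [Finset.sum_range_succ, ih]
      ring
  rw [h]
  have : (0 : ℝ) < (1 / 2) ^ (i + k) := by positivity
  linarith

/-- A null sequence of measures, bounded away from zero in variation, that is concentrated on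
disjoint open sets up to a small lower triangular error. -/
theorem HasJN.exists_concentrated [T35Space X] (h : HasJN X) :
    ∃ (ν : ℕ → X →₀ ℝ) (U : ℕ → Set X), IsNullSeq ν ∧ (∀ k, IsOpen (U k)) ∧
      Pairwise (Function.onFun Disjoint U) ∧ (∀ k, 1 / 8 ≤ mass (ν k) (U k)) ∧
      (∀ j k, j < k → ∀ x ∈ (ν j).support, x ∉ U k) ∧
      ∀ j k, k < j → mass (ν j) (U k) ≤ (1 / 2) ^ (k + 6) := by
  classical
  obtain ⟨μ, hμ, hlow, hup, hpt⟩ :=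
    h.exists_pointwise_null functionallyHausdorff_of_t35Space
  have hle : (hyperfilter ℕ : Filter ℕ) ≤ atTop := by
    rw [← Nat.cofinite_eq_atTop]
    exact hyperfilter_le_cofinite
  have hfin : ∀ (F : Finset X) {ε : ℝ}, 0 < ε →
      ∀ᶠ n in (hyperfilter ℕ : Filter ℕ), mass (μ n) F < ε := by
    intro F ε hε
    refine hle (Tendsto.eventually_lt_const hε ?_)
    simp only [mass_coe_finset]
    simpa using tendsto_finsetSum F fun x _ => (hpt x).abs
  -- A triple holds a rank, the index of a measure and an open set carrying most of it. The rank
  -- grows along the sequence and so makes the error bounds summable.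
  obtain ⟨p, hp, hr⟩ := exists_seq_of_forall_finset_exists
    (fun p : ℕ × ℕ × Set X => IsOpen p.2.2 ∧ 1 / 4 - 1 / 16 ≤ mass (μ p.2.1) p.2.2 ∧
      ∀ᶠ m in (hyperfilter ℕ : Filter ℕ), mass (μ m) (closure p.2.2) < (1 / 2) ^ (p.1 + 6))
    (fun p q => p.1 < q.1 ∧ p.2.1 < q.2.1 ∧
      mass (μ q.2.1) (closure p.2.2) < (1 / 2) ^ (p.1 + 6) ∧
      mass (μ q.2.1) (μ p.2.1).support < (1 / 2) ^ (p.1 + 6)) (by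
    intro s hs
    -- Pointwise nullity makes the mass on the exceptional set Q at most 1/16 for a suitable n. The
    -- rest of the support of `μ n` then fits in an open set whose closure has small mass for most
    -- later measures.
    obtain ⟨Q, hQ⟩ := exists_finset_forall_exists_isOpen_mass_lt hup (hyperfilter ℕ)
      (by positivity : (0 : ℝ) < (1 / 2) ^ (s.sup Prod.fst + 1 + 6))
    have hev : ∀ᶠ n in (hyperfilter ℕ : Filter ℕ), ∀ p ∈ s, p.2.1 < n ∧
        mass (μ n) (closure p.2.2) < (1 / 2) ^ (p.1 + 6) ∧
        mass (μ n) (μ p.2.1).support < (1 / 2) ^ (p.1 + 6) :=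
      (Filter.eventually_all_finset s).2 fun p hp =>
        ((eventually_gt_atTop p.2.1).filter_mono hle).and
          ((hs p hp).2.2.and (hfin _ (by positivity)))
    obtain ⟨n, hn, hnQ⟩ := (hev.and (hfin Q (by norm_num : (0 : ℝ) < 1 / 16))).exists
    obtain ⟨W, hW, htW, hWm⟩ := hQ ((μ n).support \ Q) Finset.sdiff_disjoint
    obtain ⟨O, hO, htO, hOW⟩ := ((μ n).support \ Q).finite_toSet.isCompact.exists_isOpen_closure_subset
      (hW.mem_nhdsSet.2 htW)
    refine ⟨(s.sup Prod.fst + 1, n, O), ⟨hO, ?_, hWm.mono fun m hm =>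
      (mass_mono _ hOW).trans_lt hm⟩, fun q hq => ⟨?_, hn q hq⟩⟩
    · have h1 : tv (μ n) ≤ mass (μ n) (↑Q ∪ O) := tv_le_mass fun x hx => by
        by_cases hxQ : x ∈ Q
        · exact Or.inl hxQ
        · exact Or.inr (htO (by simpa [hxQ] using hx))
      have h2 := mass_union_le (μ n) Q O
      have h3 := hlow n
      simp only
      linarith
    · exact Nat.lt_succ_of_le (Finset.le_sup (f := Prod.fst) hq))
  have hk : ∀ i, i ≤ (p i).1 := fun i =>
    (strictMono_nat_of_lt_succ fun i => (hr i (i + 1) (Nat.lt_succ_self i)).1).le_apply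
  have hn : StrictMono fun i => (p i).2.1 :=
    strictMono_nat_of_lt_succ fun i => (hr i (i + 1) (Nat.lt_succ_self i)).2.1
  have hpow : ∀ i, (1 / 2 : ℝ) ^ ((p i).1 + 6) ≤ (1 / 2) ^ (i + 6) := fun i =>
    pow_le_pow_of_le_one (by norm_num) (by norm_num) (by have := hk i; omega)
  -- Removing earlier closures gives disjointness; removing earlier supports makes the matrix of
  -- pairings triangular.
  let V : ℕ → Set X := fun i => (p i).2.2 \ ⋃ j ∈ Finset.range i, closure (p j).2.2
  let U : ℕ → Set X := fun i => V i \ ⋃ j ∈ Finset.range i, ↑(μ (p j).2.1).support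
  have hUV : ∀ i, U i ⊆ V i := fun i => Set.sdiff_subset
  refine ⟨μ ∘ fun i => (p i).2.1, U, hμ.comp hn.tendsto_atTop, fun i => ?_, fun i j hij => ?_,
    fun i => ?_, fun j i hji x hx hxU => ?_, fun j i hij => ?_⟩
  · exact ((hp i).1.diff_biUnion_closure _ _).sdiff
      (Set.Finite.isClosed_biUnion (Finset.finite_toSet _)
        fun _ _ => (Finset.finite_toSet _).isClosed)
  · exact (pairwise_disjoint_diff_closure (fun i => (p i).2.2) hij).mono (hUV i) (hUV j)
  -- Each of the two removals costs less than Σ 2^-(j+6) < 1/32, so at least 1/4 - 1/16 - 1/16 = 1/8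
  -- remains.
  · let ν := μ (p i).2.1
    have h1 : mass ν (p i).2.2 ≤ mass ν (U i ∪ ((⋃ j ∈ Finset.range i, closure (p j).2.2) ∪
        ⋃ j ∈ Finset.range i, ↑(μ (p j).2.1).support)) := by
      refine mass_mono _ fun x hx => ?_
      by_cases h1 : x ∈ ⋃ j ∈ Finset.range i, closure (p j).2.2
      · exact Or.inr (Or.inl h1)
      by_cases h2 : x ∈ ⋃ j ∈ Finset.range i, (↑(μ (p j).2.1).support : Set X)
      · exact Or.inr (Or.inr h2)
      exact Or.inl ⟨⟨hx, h1⟩, h2⟩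
    have h2 := mass_union_le ν (U i) ((⋃ j ∈ Finset.range i, closure (p j).2.2) ∪
        ⋃ j ∈ Finset.range i, ↑(μ (p j).2.1).support)
    have h3 := mass_union_le ν (⋃ j ∈ Finset.range i, closure (p j).2.2)
      (⋃ j ∈ Finset.range i, ↑(μ (p j).2.1).support)
    have h4 := mass_biUnion_le ν (Finset.range i) fun j => closure (p j).2.2
    have h5 := mass_biUnion_le ν (Finset.range i) fun j => (↑(μ (p j).2.1).support : Set X)
    have h6 : ∑ j ∈ Finset.range i, mass ν (closure (p j).2.2) ≤
        ∑ j ∈ Finset.range i, (1 / 2 : ℝ) ^ (j + (5 + 1)) := Finset.sum_le_sum fun j hj =>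
      (hr j i (Finset.mem_range.1 hj)).2.2.1.le.trans (hpow j)
    have h7 : ∑ j ∈ Finset.range i, mass ν (μ (p j).2.1).support ≤
        ∑ j ∈ Finset.range i, (1 / 2 : ℝ) ^ (j + (5 + 1)) := Finset.sum_le_sum fun j hj =>
      (hr j i (Finset.mem_range.1 hj)).2.2.2.le.trans (hpow j)
    have h8 := sum_range_half_pow_lt i 5
    have h9 := (hp i).2.1
    change 1 / 8 ≤ mass ν (U i)
    norm_num at h8 h9 ⊢
    norm_num at h6 h7
    linarith
  · exact hxU.2 (Set.mem_biUnion (Finset.mem_coe.2 (Finset.mem_range.2 hji)) hx)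
  · exact (mass_mono _ fun x hx => subset_closure hx.1.1).trans
      ((hr i j hij).2.2.1.le.trans (hpow i))

/-- A function interpolating the sign of ν is cut off by a bump that is 1 on the support inside U,
then divided by the variation on U. -/
theorem exists_peak [T35Space X] (ν : X →₀ ℝ) {U : Set X} (hU : IsOpen U) {δ : ℝ} (hδ : 0 < δ)
    (hν : δ ≤ mass ν U) :
    ∃ f : X → ℝ, Continuous f ∧ (∀ x, |f x| ≤ δ⁻¹) ∧ (∀ x ∉ U, f x = 0) ∧ pairing f ν = 1 := by
  classical
  have hpos : 0 < mass ν U := hδ.trans_le hν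
  obtain ⟨e, he, he1, hes⟩ :=
    (functionallyHausdorff_of_t35Space (X := X)).exists_interpolation ν.support
      (g := fun x => SignType.sign (ν x)) (fun x _ => by
        rcases lt_trichotomy (ν x) 0 with h | h | h <;> simp [h])
  obtain ⟨b, hb, hb1, hbt, hbU⟩ := exists_bump_of_finset (ν.support.filter (· ∈ U)) hU
    (fun x hx => (Finset.mem_filter.1 hx).2)
  refine ⟨fun x => e x * b x / mass ν U, (he.mul hb).div_const _, fun x => ?_, fun x hx => ?_, ?_⟩
  · rw [abs_div, abs_of_pos hpos, abs_mul, div_eq_mul_inv]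
    calc |e x| * |b x| * (mass ν U)⁻¹ ≤ 1 * δ⁻¹ := by
          gcongr
          exact mul_le_one₀ (he1 x) (abs_nonneg _) (hb1 x)
      _ = δ⁻¹ := one_mul _
  · simp [hbU x hx]
  · rw [pairing_eq_sum subset_rfl]
    have : ∀ x ∈ ν.support, ν x * (e x * b x / mass ν U) =
        U.indicator (fun x => |ν x|) x / mass ν U := by
      intro x hx
      by_cases hxU : x ∈ U
      · rw [hes x hx, hbt x (Finset.mem_filter.2 ⟨hx, hxU⟩), Set.indicator_of_mem hxU, mul_one,
          ← mul_div_assoc, mul_comm (ν x), sign_mul_self]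
      · simp [hbU x hxU, hxU]
    rw [Finset.sum_congr rfl this, ← Finset.sum_div, ← mass, div_self hpos.ne']

end NullSequences

/-! ### Null solutions and biorthogonality -/

section Triangular

/-- The solution of a lower triangular system with small off-diagonal entries, whose columns tend
to zero, is a null sequence if the right-hand side is. -/
theorem tendsto_zero_of_forward_substitution {a : ℕ → ℕ → ℝ} {c d : ℕ → ℝ}
    (hc : ∀ j, c j = d j - ∑ k ∈ Finset.range j, a j k * c k)
    (ha : ∀ j k, k < j → |a j k| ≤ (1 / 2) ^ (k + 3))
    (ha0 : ∀ k, Tendsto (fun j => a j k) atTop (𝓝 0)) (hd : Tendsto d atTop (𝓝 0)) :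
    Tendsto c atTop (𝓝 0) := by
  obtain ⟨D, hD⟩ := exists_abs_le_of_tendsto hd
  have hD0 : 0 ≤ D := (abs_nonneg _).trans (hD 0)
  -- The off-diagonal row sums are below 1/4, so induction gives D + 2D/4 ≤ 2D.
  have hbd : ∀ j, |c j| ≤ 2 * D := by
    intro j
    induction j using Nat.strong_induction_on with
    | _ j ih =>
      have h1 : |∑ k ∈ Finset.range j, a j k * c k| ≤
          ∑ k ∈ Finset.range j, (1 / 2 : ℝ) ^ (k + (2 + 1)) * (2 * D) := by
        refine (Finset.abs_sum_le_sum_abs _ _).trans (Finset.sum_le_sum fun k hk => ?_)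
        have hk := Finset.mem_range.1 hk
        rw [abs_mul]
        exact mul_le_mul (ha j k hk) (ih k hk) (abs_nonneg _) (by positivity)
      rw [← Finset.sum_mul] at h1
      have h2 := mul_le_mul_of_nonneg_right (sum_range_half_pow_lt j 2).le
        (by positivity : 0 ≤ 2 * D)
      have h3 := abs_sub (d j) (∑ k ∈ Finset.range j, a j k * c k)
      rw [← hc] at h3
      have h4 := hD j
      norm_num at h1 h2
      linarith
  -- Dominated convergence applies: each column tends to 0 and the rows have a common summable
  -- bound.
  have hsum : Tendsto (fun j => ∑' k, if k < j then a j k * c k else 0) atTop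
      (𝓝 (∑' _ : ℕ, (0 : ℝ))) := by
    refine tendsto_tsum_of_dominated_convergence (bound := fun k => (1 / 2 : ℝ) ^ (k + 3) * (2 * D))
      ?_ (fun k => ?_) (Eventually.of_forall fun j k => ?_)
    · exact ((summable_nat_add_iff 3).2 summable_geometric_two).mul_right _
    · refine ((ha0 k).mul_const (c k)).congr' ?_ |>.trans (by simp)
      filter_upwards [eventually_gt_atTop k] with j hj
      rw [if_pos hj]
    · split_ifs with hkj
      · rw [norm_mul]
        exact mul_le_mul (ha j k hkj) (hbd k) (norm_nonneg _) (by positivity)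
      · rw [norm_zero]
        positivity
  have h2 := hd.sub hsum
  rw [tsum_zero, sub_zero] at h2
  refine h2.congr fun j => ?_
  rw [hc j, tsum_eq_sum (s := Finset.range j) (fun k hk => if_neg (by simpa using hk))]
  congr 1
  exact Finset.sum_congr rfl fun k hk => if_pos (Finset.mem_range.1 hk)

/-- By induction the subtracted sum contributes exactly `lam j (e k)` when k < j and nothing
otherwise, so it removes precisely the entries below the diagonal. -/
theorem dual_apply_of_forward_substitution {E : Type*} [AddCommGroup E] [Module ℝ E]
    [TopologicalSpace E] {ψ lam : ℕ → E →L[ℝ] ℝ} {e : ℕ → E}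
    (hψ : ∀ j, ψ j = lam j - ∑ k ∈ Finset.range j, lam j (e k) • ψ k)
    (hdiag : ∀ j, lam j (e j) = 1) (hup : ∀ j k, j < k → lam j (e k) = 0) (j k : ℕ) :
    ψ j (e k) = if j = k then 1 else 0 := by
  induction j using Nat.strong_induction_on with
  | _ j ih =>
    have h1 : ψ j (e k) = lam j (e k) - ∑ i ∈ Finset.range j, lam j (e i) * ψ i (e k) := by
      conv_lhs => rw [hψ j]
      simp
    have h2 : ∀ i ∈ Finset.range j, lam j (e i) * ψ i (e k) =
        if i = k then lam j (e k) else 0 := by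
      intro i hi
      rw [ih i (Finset.mem_range.1 hi)]
      split_ifs with h
      · rw [h, mul_one]
      · rw [mul_zero]
    rw [h1, Finset.sum_congr rfl h2, Finset.sum_ite_eq']
    rcases lt_trichotomy j k with h | h | h
    · simp [hup j k h, h.ne]
    · subst h
      simp [hdiag]
    · simp [h, h.ne']

end Triangular

/-! ### The complemented copy of (c_0)_p -/

section Copy

variable {X : Type*} [TopologicalSpace X]

/-- Bounded continuous functions with at most one nonzero value at each point span a copy of
`(c_0)_p`. -/
theorem exists_c0p_hasSum {f : ℕ → X → ℝ} (hf : ∀ k, Continuous (f k)) {M : ℝ}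
    (hM : ∀ k x, |f k x| ≤ M) (hdisj : ∀ x, ∃ i, ∀ k, k ≠ i → f k x = 0) :
    ∃ S : C0p →L[ℝ] Cp X ℝ, ∀ c : C0p,
      HasSum (fun k => c.1 k • (⟨f k, hf k⟩ : Cp X ℝ)) (S c) := by
  choose i hi using hdisj
  have hcont : ∀ c : C0p, Continuous fun x => c.1 (i x) * f (i x) x := by
    intro c
    -- The tail after N is a single term of size at most |c_k| M with k ≥ N, so coefficients tending
    -- to 0 give uniform convergence.
    have hlim : TendstoUniformly (fun N x => ∑ k ∈ Finset.range N, c.1 k * f k x)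
        (fun x => c.1 (i x) * f (i x) x) atTop := by
      rw [Metric.tendstoUniformly_iff]
      intro ε hε
      have h0 : Tendsto (fun n => |c.1 n| * M) atTop (𝓝 0) := by
        simpa using (c.2 : Tendsto c.1 atTop (𝓝 0)).abs.mul_const M
      obtain ⟨N₀, hN₀⟩ := eventually_atTop.1 (h0.eventually_lt_const hε)
      filter_upwards [eventually_ge_atTop N₀] with N hN x
      by_cases hx : i x < N
      · rw [Finset.sum_eq_single_of_mem (i x) (Finset.mem_range.2 hx)
          (fun k _ hk => by rw [hi x k hk, mul_zero]), dist_self]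
        exact hε
      · rw [Finset.sum_eq_zero fun k hk => by
          rw [hi x k (by have := Finset.mem_range.1 hk; omega), mul_zero], Real.dist_eq, sub_zero,
          abs_mul]
        exact (mul_le_mul_of_nonneg_left (hM _ _) (abs_nonneg _)).trans_lt
          (hN₀ _ (hN.trans (not_lt.1 hx)))
    exact hlim.continuous (Frequently.of_forall fun N =>
      continuous_finsetSum _ fun k _ => continuous_const.mul (hf k))
  let S : C0p →L[ℝ] Cp X ℝ :=
    { toFun := fun c => ⟨_, hcont c⟩
      map_add' := fun c d => Subtype.ext (funext fun x => add_mul _ _ _)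
      map_smul' := fun r c => Subtype.ext (funext fun x => mul_assoc _ _ _)
      cont := continuous_induced_rng.2 (continuous_pi fun x =>
        ((continuous_apply (i x)).comp continuous_subtype_val).mul continuous_const) }
  refine ⟨S, fun c => ?_⟩
  have hind : IsInducing ((continuousSubmodule X ℝ ℝ).subtype : Cp X ℝ → X → ℝ) :=
    IsInducing.subtypeVal
  refine (hind.hasSum_iff (g := (continuousSubmodule X ℝ ℝ).subtype) _ _).1 ?_
  refine Pi.hasSum.2 fun x => ?_
  exact hasSum_single (i x) fun k hk => by simp [hi x k hk]

/-- S sums the peaks and T lists the values of the corrected functionals `ψ`. Smallness of the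
triangular error keeps `ψ` pointwise null, so T lands in (c_0)_p; biorthogonality gives T ∘ S = id.
-/
theorem HasJN.containsComplementedCopy [T35Space X] (h : HasJN X) :
    ContainsComplementedCopy (Cp X ℝ) C0p := by
  obtain ⟨ν, U, hν, hU, hd, hmass, hup, hlow⟩ := h.exists_concentrated
  choose f hf hf8 hf0 hf1 using fun k => exists_peak (ν k) (hU k) (by norm_num) (hmass k)
  let e : ℕ → Cp X ℝ := fun k => ⟨f k, hf k⟩
  obtain ⟨ψ, hψ⟩ := exists_forward_substitution (fun j k => pairing (f k) (ν j))
    (fun j => measureCLM (ν j))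
  have hdual := dual_apply_of_forward_substitution (e := e) (lam := fun j => measureCLM (ν j))
    (ψ := ψ) (fun j => by simpa [e] using hψ j) (fun j => by simpa [e] using hf1 j)
    (fun j k hjk => by
      rw [measureCLM_apply, pairing_eq_sum subset_rfl]
      exact Finset.sum_eq_zero fun x hx => by simp [e, hf0 k x (hup j k hjk x hx)])
  have hnull : ∀ g, Tendsto (fun j => ψ j g) atTop (𝓝 0) := by
    intro g
    refine tendsto_zero_of_forward_substitution (d := fun j => pairing g.1 (ν j))
      (a := fun j k => pairing (f k) (ν j)) (fun j => ?_) (fun j k hkj => ?_)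
      (fun k => hν (f k) (hf k)) (hν g.1 g.2)
    · conv_lhs => rw [hψ j]
      simp
    · have h1 := abs_pairing_le_mass (μ := ν j) (A := U k) (fun x _ => hf8 k x)
        (fun x _ hx => hf0 k x hx)
      have h2 := hlow j k hkj
      -- The peaks are bounded by 8 = 2^3, which turns the exponent k + 6 into the k + 3 needed for
      -- the triangular system.
      calc |pairing (f k) (ν j)| ≤ (1 / 8)⁻¹ * mass (ν j) (U k) := h1
        _ ≤ (1 / 8)⁻¹ * (1 / 2) ^ (k + 6) := by gcongr
        _ = (1 / 2) ^ (k + 3) := by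
          rw [pow_add, pow_add]
          ring
  let T : Cp X ℝ →L[ℝ] C0p :=
    { toFun := fun g => ⟨fun j => ψ j g, hnull g⟩
      map_add' := fun g g' => Subtype.ext (funext fun j => map_add (ψ j) g g')
      map_smul' := fun r g => Subtype.ext (funext fun j => map_smul (ψ j) r g)
      cont := continuous_induced_rng.2 (continuous_pi fun j => (ψ j).continuous) }
  obtain ⟨S, hS⟩ := exists_c0p_hasSum hf hf8 (fun x => by
    by_cases hx : ∃ i, x ∈ U i
    · obtain ⟨i, hi⟩ := hx
      exact ⟨i, fun k hk => hf0 k x fun hxk => Set.disjoint_left.1 (hd hk) hxk hi⟩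
    · push Not at hx
      exact ⟨0, fun k _ => hf0 k x (hx k)⟩)
  refine .of_comp_eq_id S T fun c => Subtype.ext (funext fun j => ?_)
  have h1 := (hS c).mapL (ψ j)
  have h2 : HasSum (fun k => ψ j (c.1 k • e k)) (c.1 j) := by
    convert hasSum_ite_eq j (c.1 j) using 2 with k
    rw [map_smul, hdual j k, smul_eq_mul]
    by_cases hjk : j = k
    · simp [hjk]
    · simp [hjk, Ne.symm hjk]
  exact h1.unique h2

end Copy

/-! ### The factors as complemented subspaces, and the equivalences -/

section Product

variable {X Y : Type*} [TopologicalSpace X] [TopologicalSpace Y]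

/-- `C_p(X)` is a complemented subspace of `C_p(X, C_p(Y))`. -/
theorem exists_comp_eq_id_left (y : Y) : ∃ (S : Cp X ℝ →L[ℝ] Cp X (Cp Y ℝ))
    (T : Cp X (Cp Y ℝ) →L[ℝ] Cp X ℝ), ∀ f, T (S f) = f := by
  refine ⟨
    { toFun := fun f => ⟨fun x => ⟨fun _ => f.1 x, continuous_const⟩,
        continuous_induced_rng.2 (continuous_pi fun _ => f.2)⟩
      map_add' := fun _ _ => rfl
      map_smul' := fun _ _ => rfl
      cont := continuous_induced_rng.2 (continuous_pi fun x => continuous_induced_rng.2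
        (continuous_pi fun _ => (continuous_apply x).comp continuous_subtype_val)) },
    { toFun := fun F => ⟨fun x => (F.1 x).1 y,
        (continuous_apply y).comp (continuous_subtype_val.comp F.2)⟩
      map_add' := fun _ _ => rfl
      map_smul' := fun _ _ => rfl
      cont := continuous_induced_rng.2 (continuous_pi fun x => (continuous_apply y).comp
        (continuous_subtype_val.comp ((continuous_apply x).comp continuous_subtype_val))) },
    fun _ => rfl⟩

/-- `C_p(Y)` is a complemented subspace of `C_p(X, C_p(Y))`. -/
theorem exists_comp_eq_id_right (x : X) : ∃ (S : Cp Y ℝ →L[ℝ] Cp X (Cp Y ℝ))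
    (T : Cp X (Cp Y ℝ) →L[ℝ] Cp Y ℝ), ∀ g, T (S g) = g := by
  refine ⟨
    { toFun := fun g => ⟨fun _ => g, continuous_const⟩
      map_add' := fun _ _ => rfl
      map_smul' := fun _ _ => rfl
      cont := continuous_induced_rng.2 (continuous_pi fun _ => continuous_id) },
    { toFun := fun F => F.1 x
      map_add' := fun _ _ => rfl
      map_smul' := fun _ _ => rfl
      cont := (continuous_apply x).comp continuous_subtype_val },
    fun _ => rfl⟩

end Product

theorem mainTheorem1 (X Y : Type*) [TopologicalSpace X] [TopologicalSpace Y]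
    [T35Space X] [T35Space Y] [Infinite X] [Infinite Y] :
    List.TFAE [
      HasJNP (Cp X (Cp Y ℝ)),
      ContainsComplementedCopy (Cp X (Cp Y ℝ)) C0p,
      MapsLinearlyOnto (Cp X (Cp Y ℝ)) C0p,
      ContainsComplementedCopy (Cp X ℝ) C0p ∨ ContainsComplementedCopy (Cp Y ℝ) C0p,
      MapsLinearlyOnto (Cp X ℝ) C0p ∨ MapsLinearlyOnto (Cp Y ℝ) C0p,
      HasJNP (Cp X ℝ) ∨ HasJNP (Cp Y ℝ)] := by
  have hX : FunctionallyHausdorff X := functionallyHausdorff_of_t35Space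
  have hY : FunctionallyHausdorff Y := functionallyHausdorff_of_t35Space
  have hZ : FunctionallyHausdorff (SepProd X Y) := SepProd.functionallyHausdorff hX hY
  obtain ⟨x₀⟩ : Nonempty X := inferInstance
  obtain ⟨y₀⟩ : Nonempty Y := inferInstance
  tfae_have 1 → 6 := fun h => by
    rcases ((h.of_equiv cpCpEquiv).hasJN hZ).of_sepProd with h | h
    · exact .inl (h.hasJNP hX)
    · exact .inr (h.hasJNP hY)
  tfae_have 6 → 4 := fun h =>
    h.imp (fun h => (h.hasJN hX).containsComplementedCopy)
      (fun h => (h.hasJN hY).containsComplementedCopy)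
  tfae_have 4 → 5 := fun h => h.imp (fun h => h.mapsLinearlyOnto) (fun h => h.mapsLinearlyOnto)
  tfae_have 5 → 6 := fun h => h.imp (fun h => h.hasJNP hX) (fun h => h.hasJNP hY)
  tfae_have 4 → 2 := fun h => by
    rcases h with h | h
    · obtain ⟨S, T, hTS⟩ := exists_comp_eq_id_left (X := X) y₀
      exact h.trans_of_comp_eq_id S T hTS
    · obtain ⟨S, T, hTS⟩ := exists_comp_eq_id_right (Y := Y) x₀
      exact h.trans_of_comp_eq_id S T hTS
  tfae_have 2 → 3 := fun h => h.mapsLinearlyOnto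
  -- The implication from surjection to JNP is applied to C_p(Z) and transported back; it needs only
  -- that continuous functions separate the points of Z.
  tfae_have 3 → 1 := fun h =>
    ((h.comp_left (cpCpEquiv (X := X) (Y := Y)).symm.toContinuousLinearMap
      cpCpEquiv.symm.surjective).hasJNP hZ).of_equiv cpCpEquiv.symm
  tfae_finish
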